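/- Let $k$ be a field of characteristic zero and let $A=kQ/I$ be a gentle algebra: $Q$ is a finite quiver (paths are read from left to right), $I$ is an admissible ideal generated by paths of length two, and for every arrow $\alpha$ there is at most one arrow $\beta$ with $s(\beta)=t(\alpha)$ and $\alpha\beta\in I$, at most one arrow $\beta'$ with $s(\beta')=t(\alpha)$ and $\alpha\beta'\notin I$, at most one arrow $\gamma$ with $t(\gamma)=s(\alpha)$ and $\gamma\alpha\in I$, and at most one arrow $\gamma'$ with $t(\gamma')=s(\alpha)$ and $\gamma'\alpha\notin I$. Assume that $Q$ contains a subquiver of the form $(\star)$, that is, pairwise distinct vertices $1,\dots,6$, arrows $\alpha_1:1\to2$, $\alpha_2:2\to3$, $\alpha_3:3\to4$, $\gamma_1:2\to5$, $\gamma_2:5\to3$, $\rho:5\to6$, $\delta_1:3\to6$, a path $\delta_2\cdots\delta_s$ from $6$ to $4$ ($s\ge2$) and a path $v'=\beta_1\cdots\beta_m$ from $1$ to $2$ ($m\ge1$), where all the vertices (including the inner vertices of the two paths) and all the arrows are pairwise distinct. Assume that $\alpha_1\alpha_2=0=\alpha_2\alpha_3$ in $A$ and that $v'$, $\gamma_1\gamma_2$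 and $w'=\delta_1\delta_2\cdots\delta_s$ are nonzero in $A$; put $\omega=(\alpha_1,\alpha_2,\alpha_3)$. (For instance, $Q$ may be equal to $(\star)$.) Let $E=kQ_0$, let $AP_2$ be the set of pairs $(a_1,a_2)$ of composable arrows with $a_1a_2\in I$, and $AP_3$ the set of triples of arrows $(a_1,a_2,a_3)$ with $(a_1,a_2),(a_2,a_3)\in AP_2$. Let $B^1(A)[1]=\mathrm{Hom}_{E-E}(kAP_2,A)$ and $B^2(A)[1]=\mathrm{Hom}_{E-E}(kAP_3,A)$ be the components of degrees $1$ and $2$ of the shifted Bardzell complex $B^*(A)[1]$. For $a_1a_2\in I$ and $u\in A$ a combination of nonzero paths parallel to $a_1a_2$, write $(a_1a_2\|u)$ for the element of $B^1(A)[1]$ with value $u$ at $(a_1,a_2)$ and $0$ elsewhere. Let $F_*,G_*$ be the comparison maps between Bardzell's resolution and the bar resolution $(C_*(A),d_*)$ with $C_n(A)=A\otimes A^{\otimes n}\otimes A$: $F_n(1\otimes(a_1,\dots,a_n)\otimes1)=1\otimes a_1\otimes\cdots\otimes a_n\otimes1$; $G_1(1\otimes b_1\cdots b_r\otimes1)=\sum_i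 b_1\cdots b_{i-1}\otimes b_i\otimes b_{i+1}\cdots b_r$; and, for nonzero paths $x=ua$, $y=bv$ with last arrow $a$ and first arrow $b$, $G_2(1\otimes x\otimes y\otimes1)=u\otimes(a,b)\otimes v$ if $ab\in I$, all other values of $G_2(1\otimes x\otimes y\otimes 1)$ on nonzero paths $x,y$ (possibly trivial) being zero. Let $H_0=0$ and $H_n=\mathrm{Id}\otimes F_nG_ns_{n-1}-\mathrm{Id}\otimes H_{n-1}d_ns_{n-1}$, with $s_n(x)=1\otimes x$, and let $F^*,G^*,H^*$ be the maps induced on cochains. Let $l_n$ be the brackets of the $L_\infty$-structure on $B^*(A)[1]$ transferred from the Gerstenhaber bracket of the Hochschild complex. On elements $f_1,\dots,f_n\in B^1(A)[1]$ they are given by $l_1(f)(a_1,a_2,a_3)=f(a_1,a_2)a_3-a_1f(a_2,a_3)$, $\phi_1=G^*$ and, for $n\ge2$, $l_n=F^*v_n$, $\phi_n=H^*v_n$, where $$v_n(f_1,\dots,f_n)=\sum_{t=1}^{n-1}\ \sum_{\tau}(-1)^{(t-1)+(n-t-1)t}\,\bigl[\phi_t(f_{\tau(1)},\dots,f_{\tau(t)}),\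 \phi_{n-t}(f_{\tau(t+1)},\dots,f_{\tau(n)})\bigr],$$ the inner sum running over the $(t,n-t)$-shuffles $\tau$ with $\tau(1)<\tau(t+1)$, and $[\ ,\ ]$ being the Gerstenhaber bracket, $[g,h]=g(h\otimes\mathrm{Id}-\mathrm{Id}\otimes h)+h(g\otimes\mathrm{Id}-\mathrm{Id}\otimes g)$ on $2$-cochains. Then the pairs $(\gamma_2,\delta_1)$ and $(\gamma_1,\rho)$ are also in $AP_2$, and the element $$f=(\alpha_1\alpha_2\|v'\alpha_2+\alpha_1\gamma_1\gamma_2)+(\alpha_2\alpha_3\|\gamma_1\gamma_2\alpha_3+\alpha_2w')+(\gamma_2\delta_1\|\rho)+(\gamma_1\rho\|\alpha_2\delta_1)\in B^1(A)[1]$$ satisfies, for every $j\ge1$ and $n=2+3j$, $$l_n(f,\dots,f)(\omega)=-(-1)^{\frac{j(j+1)}2}\,n!\;v'\alpha_2w'\neq0 .$$ Consequently the $L_\infty$-structure is not nilpotent: there is no $N$ such that $l_n(f_1,\dots,f_n)=0$ for all $n\ge N$ and all $f_1,\dots,f_n\in B^1(A)[1]$. -/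

import Mathlib

open scoped TensorProduct

noncomputable section

/-! ### Quivers with quadratic monomial relations and the algebras `kQ/I` -/

/-- A quiver with vertices `Q₀`, arrows `Q₁`, source and target maps, together with a set `R` of
paths of length two, written as pairs of composable arrows. Paths are read from left to right. It
presents the quadratic monomial algebra `kQ/I`, where `I` is the ideal generated by `R`. -/
structure BoundQuiver (Q₀ Q₁ : Type*) where
  s : Q₁ → Q₀
  t : Q₁ → Q₀
  R : Set (Q₁ × Q₁)
  composable : ∀ r ∈ R, t r.1 = s r.2

namespace BoundQuiver

variable {Q₀ Q₁ : Type*} (X : BoundQuiver Q₀ Q₁)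

/-- `X.IsPath v l`: the list of arrows `l` is a path starting at `v`
(the empty list is the trivial path at `v`). -/
def IsPath : Q₀ → List Q₁ → Prop
  | _, [] => True
  | v, a :: l => X.s a = v ∧ IsPath (X.t a) l

/-- The terminal vertex of the path `l` starting at `v`. -/
def target : Q₀ → List Q₁ → Q₀
  | v, [] => v
  | _, a :: l => target (X.t a) l

/-- A path is nonzero in `kQ/I` if no two consecutive arrows form a relation. -/
def IsNonzeroPath (v : Q₀) (l : List Q₁) : Prop :=
  X.IsPath v l ∧ l.IsChain (fun a b => (a, b) ∉ X.R)

/-- The nonzero paths of `kQ/I`, as pairs (starting vertex, list of arrows). -/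
def NPath : Type _ := {p : Q₀ × List Q₁ // X.IsNonzeroPath p.1 p.2}

/-- The algebra `A = kQ/I`, on its basis of nonzero paths. The multiplication is defined below, and
`toAlg_surjective`, `toAlg_eq_zero_iff` show that this is the quotient of the path algebra by the
two-sided ideal generated by `R`. -/
def Alg (k : Type*) [Field k] : Type _ := X.NPath →₀ k

section Algebra

variable (k : Type*) [Field k]

instance : AddCommGroup (X.Alg k) := inferInstanceAs (AddCommGroup (X.NPath →₀ k))
instance : Module k (X.Alg k) := inferInstanceAs (Module k (X.NPath →₀ k))

variable {k} in
/-- The linear map out of `A` with prescribed values on the nonzero paths. -/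
def onPaths {M : Type*} [AddCommGroup M] [Module k M] (g : X.NPath → M) : X.Alg k →ₗ[k] M :=
  Finsupp.linearCombination k g

open Classical in
/-- The class in `A` of the path `l` starting at `v`
(zero if `l` is not a path starting at `v`, or if it contains a relation). -/
def path (v : Q₀) (l : List Q₁) : X.Alg k :=
  if h : X.IsNonzeroPath v l then Finsupp.single (⟨(v, l), h⟩ : X.NPath) (1 : k) else 0

/-- The trivial path at `v`. -/
def idem (v : Q₀) : X.Alg k := X.path k v []

/-- The class of an arrow. -/
def arrow (a : Q₁) : X.Alg k := X.path k (X.s a) [a]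

open Classical in
/-- The multiplication of `A`: concatenation of paths. -/
def mulMap : X.Alg k →ₗ[k] X.Alg k →ₗ[k] X.Alg k :=
  X.onPaths fun p => X.onPaths fun q =>
    if X.target p.1.1 p.1.2 = q.1.1 then X.path k p.1.1 (p.1.2 ++ q.1.2) else 0

instance : Mul (X.Alg k) := ⟨fun a b => X.mulMap k a b⟩

instance [Fintype Q₀] : One (X.Alg k) := ⟨∑ v, X.idem k v⟩

theorem mul_def (a b : X.Alg k) : a * b = X.mulMap k a b := rfl

variable {X}

theorem isPath_append (v : Q₀) (l m : List Q₁) :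
    X.IsPath v (l ++ m) ↔ X.IsPath v l ∧ X.IsPath (X.target v l) m := by
  induction l generalizing v with
  | nil => simp [IsPath, target]
  | cons a l ih => simp [IsPath, target, ih, and_assoc]

theorem target_append (v : Q₀) (l m : List Q₁) :
    X.target v (l ++ m) = X.target (X.target v l) m := by
  induction l generalizing v with
  | nil => rfl
  | cons a l ih => simp [target, ih]

theorem IsNonzeroPath.of_append {v : Q₀} {l m : List Q₁} (h : X.IsNonzeroPath v (l ++ m)) :
    X.IsNonzeroPath v l ∧ X.IsNonzeroPath (X.target v l) m := by
  obtain ⟨h1, h2⟩ := h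
  rw [isPath_append] at h1
  rw [List.isChain_append] at h2
  exact ⟨⟨h1.1, h2.1⟩, ⟨h1.2, h2.2.1⟩⟩

theorem path_of_nonzero {v : Q₀} {l : List Q₁} (h : X.IsNonzeroPath v l) :
    X.path k v l = Finsupp.single (⟨(v, l), h⟩ : X.NPath) (1 : k) := dif_pos h

theorem path_of_not {v : Q₀} {l : List Q₁} (h : ¬ X.IsNonzeroPath v l) :
    X.path k v l = 0 := dif_neg h

theorem onPaths_path {M : Type*} [AddCommGroup M] [Module k M] (g : X.NPath → M)
    {v : Q₀} {l : List Q₁} (h : X.IsNonzeroPath v l) :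
    X.onPaths g (X.path k v l) = g ⟨(v, l), h⟩ := by
  rw [path_of_nonzero k h]
  exact (Finsupp.linearCombination_single k _ _).trans (one_smul k _)

open Classical in
/-- The product of two paths is their concatenation if they are composable, and zero otherwise. -/
theorem path_mul_path (v w : Q₀) (l m : List Q₁) :
    X.path k v l * X.path k w m = if X.target v l = w then X.path k v (l ++ m) else 0 := by
  rw [mul_def]
  by_cases hl : X.IsNonzeroPath v l
  · by_cases hm : X.IsNonzeroPath w m
    · rw [mulMap, onPaths_path k _ hl, onPaths_path k _ hm]
    · rw [path_of_not k hm, map_zero]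
      split_ifs with h
      · subst h
        exact (path_of_not k fun h' => hm h'.of_append.2).symm
      · rfl
  · rw [path_of_not k hl, map_zero, LinearMap.zero_apply]
    split_ifs with h
    · exact (path_of_not k fun h' => hl h'.of_append.1).symm
    · rfl

/-- Two linear maps that agree on all nonzero paths are equal. -/
theorem alg_hom_ext {M : Type*} [AddCommGroup M] [Module k M] {f g : X.Alg k →ₗ[k] M}
    (h : ∀ v l, X.IsNonzeroPath v l → f (X.path k v l) = g (X.path k v l)) : f = g := by
  refine Finsupp.lhom_ext' fun p => LinearMap.ext_ring ?_
  have := h p.1.1 p.1.2 p.2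
  rw [path_of_nonzero k p.2] at this
  exact this

theorem path_mul_assoc (u v w : Q₀) (l m n : List Q₁) :
    X.path k u l * X.path k v m * X.path k w n = X.path k u l * (X.path k v m * X.path k w n) := by
  have mz : ∀ a : X.Alg k, a * 0 = 0 := fun a => map_zero _
  have zm : ∀ a : X.Alg k, 0 * a = 0 := fun a => by
    rw [mul_def, map_zero, LinearMap.zero_apply]
  rw [path_mul_path, path_mul_path]
  by_cases h1 : X.target u l = v
  · by_cases h2 : X.target v m = w
    · simp [h1, h2, path_mul_path, target_append]
    · simp [h1, h2, path_mul_path, target_append, mz]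
  · by_cases h2 : X.target v m = w
    · simp [h1, h2, path_mul_path, zm]
    · simp [h1, h2, zm, mz]

theorem alg_mul_assoc (a b c : X.Alg k) : a * b * c = a * (b * c) := by
  have e1 : ∀ v l w m, (X.mulMap k (X.mulMap k (X.path k v l) (X.path k w m))) =
      (X.mulMap k (X.path k v l)) ∘ₗ (X.mulMap k (X.path k w m)) := fun v l w m =>
    alg_hom_ext k fun u n _ => path_mul_assoc k v w u l m n
  have e2 : ∀ v l, (X.mulMap k) ∘ₗ (X.mulMap k (X.path k v l)) =
      (LinearMap.llcomp k (X.Alg k) (X.Alg k) (X.Alg k) (X.mulMap k (X.path k v l))) ∘ₗ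
        X.mulMap k := fun v l =>
    alg_hom_ext k fun w m _ => e1 v l w m
  have e3 : (LinearMap.llcomp k (X.Alg k) (X.Alg k) (X.Alg k →ₗ[k] X.Alg k) (X.mulMap k)) ∘ₗ
        X.mulMap k =
      ((LinearMap.lcomp k (X.Alg k →ₗ[k] X.Alg k) (X.mulMap k)) ∘ₗ
        (LinearMap.llcomp k (X.Alg k) (X.Alg k) (X.Alg k))) ∘ₗ X.mulMap k :=
    alg_hom_ext k fun v l _ => e2 v l
  exact LinearMap.congr_fun (LinearMap.congr_fun (LinearMap.congr_fun e3 a) b) c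

theorem idem_mul_idem (v : Q₀) : X.idem k v * X.idem k v = X.idem k v := by
  rw [idem, path_mul_path]
  simp [target]

theorem idem_mul_arrow (a : Q₁) : X.idem k (X.s a) * X.arrow k a = X.arrow k a := by
  rw [idem, arrow, path_mul_path]
  simp [target]

theorem arrow_mul_idem (a : Q₁) : X.arrow k a * X.idem k (X.t a) = X.arrow k a := by
  rw [idem, arrow, path_mul_path]
  simp [target]

theorem alg_induction {P : X.Alg k → Prop} (x : X.Alg k) (zero : P 0)
    (add : ∀ x y, P x → P y → P (x + y))
    (smul_path : ∀ (r : k) v l, X.IsNonzeroPath v l → P (r • X.path k v l)) : P x := by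
  refine Finsupp.induction_linear (motive := P) x zero add ?_
  intro p r
  have e : (Finsupp.single p r : X.Alg k) = r • X.path k p.1.1 p.1.2 := by
    rw [path_of_nonzero k p.2]
    exact (Finsupp.smul_single_one p r).symm
  rw [e]
  exact smul_path r _ _ p.2

variable (X)

/-- The quiver `Q` without relations; `X.free.Alg k` is the path algebra `kQ`. -/
def free : BoundQuiver Q₀ Q₁ := ⟨X.s, X.t, ∅, by simp⟩

theorem free_isPath (v : Q₀) (l : List Q₁) : X.free.IsPath v l ↔ X.IsPath v l := by
  induction l generalizing v with
  | nil => rfl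
  | cons a l ih => exact and_congr Iff.rfl (ih _)

theorem free_isNonzeroPath (v : Q₀) (l : List Q₁) :
    X.free.IsNonzeroPath v l ↔ X.IsPath v l := by
  rw [IsNonzeroPath, free_isPath, and_iff_left_iff_imp]
  intro _
  rw [List.isChain_iff_getElem]
  exact fun _ _ h => h

theorem free_target (v : Q₀) (l : List Q₁) : X.free.target v l = X.target v l := by
  induction l generalizing v with
  | nil => rfl
  | cons a l ih => exact ih _

variable {X}

variable [Fintype Q₀]

theorem alg_one_mul (a : X.Alg k) : 1 * a = a := by
  classical
  have : X.mulMap k (∑ v, X.idem k v) = LinearMap.id := alg_hom_ext k fun v l _ => by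
    rw [map_sum, LinearMap.sum_apply]
    have : ∀ w, X.mulMap k (X.idem k w) (X.path k v l) = if w = v then X.path k v l else 0 :=
      fun w => (path_mul_path k w v [] l).trans (by
        by_cases h : w = v
        · subst h; simp [target]
        · simp [target, h])
    simp [this]
  exact LinearMap.congr_fun this a

theorem alg_mul_one (a : X.Alg k) : a * 1 = a := by
  classical
  have : (X.mulMap k).flip (∑ v, X.idem k v) = LinearMap.id := alg_hom_ext k fun v l _ => by
    rw [map_sum, LinearMap.sum_apply]
    have : ∀ w, (X.mulMap k).flip (X.idem k w) (X.path k v l) =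
        if X.target v l = w then X.path k v l else 0 :=
      fun w => (path_mul_path k v w l []).trans (by simp)
    simp [this]
  exact LinearMap.congr_fun this a

instance : Ring (X.Alg k) :=
  { (inferInstance : AddCommGroup (X.Alg k)) with
    mul := (· * ·)
    one := 1
    mul_assoc := alg_mul_assoc k
    one_mul := alg_one_mul k
    mul_one := alg_mul_one k
    left_distrib := fun a b c => map_add (X.mulMap k a) b c
    right_distrib := fun a b c => by simp only [mul_def, map_add, LinearMap.add_apply]
    zero_mul := fun a => by simp only [mul_def, map_zero, LinearMap.zero_apply]
    mul_zero := fun a => map_zero (X.mulMap k a) }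

instance : Algebra k (X.Alg k) :=
  Algebra.ofModule
    (fun r a b => by simp only [mul_def, map_smul, LinearMap.smul_apply])
    (fun r a b => map_smul (X.mulMap k a) r b)

variable (X)

/-- The two-sided ideal `I` of `kQ` generated by the relations. -/
def relIdeal : TwoSidedIdeal (X.free.Alg k) :=
  TwoSidedIdeal.span {x | ∃ r ∈ X.R, x = X.free.path k (X.s r.1) [r.1, r.2]}

/-- The linear map from `kQ` to `A` that sends every path to its class. -/
def toAlgLin : X.free.Alg k →ₗ[k] X.Alg k := X.free.onPaths fun p => X.path k p.1.1 p.1.2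

theorem toAlgLin_path (v : Q₀) (l : List Q₁) :
    X.toAlgLin k (X.free.path k v l) = X.path k v l := by
  by_cases h : X.IsPath v l
  · exact onPaths_path k _ ((X.free_isNonzeroPath v l).2 h)
  · rw [path_of_not k fun h' => h ((X.free_isNonzeroPath v l).1 h'), map_zero,
      path_of_not k fun h' => h h'.1]

theorem toAlgLin_one : X.toAlgLin k 1 = 1 := by
  change X.toAlgLin k (∑ v, X.free.idem k v) = ∑ v, X.idem k v
  rw [map_sum]
  exact Finset.sum_congr rfl fun v _ => X.toAlgLin_path k v []

theorem toAlgLin_mul (a b : X.free.Alg k) :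
    X.toAlgLin k (a * b) = X.toAlgLin k a * X.toAlgLin k b := by
  classical
  have e : (X.free.mulMap k).compr₂ (X.toAlgLin k) =
      (X.mulMap k).compl₁₂ (X.toAlgLin k) (X.toAlgLin k) :=
    alg_hom_ext k fun v l _ => alg_hom_ext k fun w m _ => by
      have h1 := path_mul_path (X := X.free) k v w l m
      have h2 := path_mul_path (X := X) k v w l m
      rw [mul_def] at h1 h2
      simp only [LinearMap.compr₂_apply, LinearMap.compl₁₂_apply, toAlgLin_path, h1, h2,
        free_target]
      split_ifs
      · exact X.toAlgLin_path k _ _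
      · exact map_zero _
  exact LinearMap.congr_fun (LinearMap.congr_fun e a) b

/-- The algebra map from the path algebra `kQ` to `A` that sends every path to its class. -/
def toAlg : X.free.Alg k →ₐ[k] X.Alg k :=
  AlgHom.ofLinearMap (X.toAlgLin k) (X.toAlgLin_one k) (X.toAlgLin_mul k)

theorem toAlg_path (v : Q₀) (l : List Q₁) : X.toAlg k (X.free.path k v l) = X.path k v l :=
  X.toAlgLin_path k v l

/-- The linear section of `toAlg` given by the basis of nonzero paths. -/
def liftLin : X.Alg k →ₗ[k] X.free.Alg k := X.onPaths fun p => X.free.path k p.1.1 p.1.2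

theorem toAlg_liftLin (a : X.Alg k) : X.toAlg k (X.liftLin k a) = a := by
  have e : (X.toAlg k).toLinearMap ∘ₗ X.liftLin k = LinearMap.id :=
    alg_hom_ext k fun v l h => by
      rw [LinearMap.comp_apply, liftLin, onPaths_path k _ h]
      exact X.toAlg_path k v l
  exact LinearMap.congr_fun e a

/-- The algebra `A` is a quotient of the path algebra. -/
theorem toAlg_surjective : Function.Surjective (X.toAlg k) :=
  fun a => ⟨_, X.toAlg_liftLin k a⟩

theorem path_mem_relIdeal {v : Q₀} {l : List Q₁} (h : X.IsPath v l)
    (hl : ¬ l.IsChain (fun a b => (a, b) ∉ X.R)) : X.free.path k v l ∈ X.relIdeal k := by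
  classical
  induction l generalizing v with
  | nil => simp at hl
  | cons a l ih =>
    obtain ⟨rfl, h⟩ := h
    by_cases hc : l.IsChain (fun a b => (a, b) ∉ X.R)
    · cases l with
      | nil => simp at hl
      | cons b l =>
        rw [List.isChain_cons_cons, not_and_or, not_not] at hl
        have hR : (a, b) ∈ X.R := hl.resolve_right fun h' => h' hc
        have e : X.free.path k (X.s a) (a :: b :: l) =
            X.free.path k (X.s a) [a, b] * X.free.path k (X.t b) l := by
          rw [path_mul_path, free_target]
          simp [target]
        rw [e]
        exact TwoSidedIdeal.mul_mem_right _ _ _ (TwoSidedIdeal.subset_span ⟨(a, b), hR, rfl⟩)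
    · have e : X.free.path k (X.s a) (a :: l) =
          X.free.path k (X.s a) [a] * X.free.path k (X.t a) l := by
        rw [path_mul_path, free_target]
        simp [target]
      rw [e]
      exact TwoSidedIdeal.mul_mem_left _ _ _ (ih h hc)

/-- The kernel of `kQ → A` is the ideal generated by the relations, so that `A = kQ/I`. -/
theorem toAlg_eq_zero_iff (x : X.free.Alg k) : X.toAlg k x = 0 ↔ x ∈ X.relIdeal k := by
  constructor
  · intro hx
    have key : ∀ y : X.free.Alg k, y - X.liftLin k (X.toAlg k y) ∈ X.relIdeal k := by
      intro y
      refine alg_induction k (P := fun y => y - X.liftLin k (X.toAlg k y) ∈ X.relIdeal k) y ?_ ?_ ?_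
      · rw [map_zero, map_zero, sub_zero]
        exact TwoSidedIdeal.zero_mem _
      · intro f g hf hg
        rw [map_add, map_add, add_sub_add_comm]
        exact TwoSidedIdeal.add_mem _ hf hg
      · intro r v l hl
        rw [map_smul, map_smul, ← smul_sub, Algebra.smul_def]
        refine TwoSidedIdeal.mul_mem_left _ _ _ ?_
        rw [toAlg_path]
        have hp := (X.free_isNonzeroPath v l).1 hl
        by_cases hc : l.IsChain (fun a b => (a, b) ∉ X.R)
        · rw [liftLin, onPaths_path k _ ⟨hp, hc⟩, sub_self]
          exact TwoSidedIdeal.zero_mem _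
        · rw [path_of_not k fun h => hc h.2, map_zero, sub_zero]
          exact X.path_mem_relIdeal k hp hc
    have := key x
    rwa [hx, map_zero, sub_zero] at this
  · intro hx
    have hle : X.relIdeal k ≤ TwoSidedIdeal.ker (X.toAlg k) := by
      refine TwoSidedIdeal.span_le.2 ?_
      rintro _ ⟨r, hr, rfl⟩
      refine (TwoSidedIdeal.mem_ker _).2 ?_
      rw [toAlg_path]
      refine path_of_not k fun h => ?_
      have := h.2
      rw [List.isChain_pair] at this
      exact this hr
    exact (TwoSidedIdeal.mem_ker _).1 (hle hx)

end Algebra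

/-! ### Gentle algebras -/

/-- The algebra `kQ/I` is gentle. The clause `admissible` says that all long enough paths are zero,
so that `I` is admissible (and `kQ/I` is finite dimensional). -/
structure IsGentle : Prop where
  finite_vertices : Finite Q₀
  finite_arrows : Finite Q₁
  admissible : ∃ N : ℕ, ∀ v l, X.IsNonzeroPath v l → l.length < N
  rel_right : ∀ a b b', (a, b) ∈ X.R → (a, b') ∈ X.R → b = b'
  rel_left : ∀ a c c', (c, a) ∈ X.R → (c', a) ∈ X.R → c = c'
  nonrel_right : ∀ a b b', X.s b = X.t a → X.s b' = X.t a →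
    (a, b) ∉ X.R → (a, b') ∉ X.R → b = b'
  nonrel_left : ∀ a c c', X.t c = X.s a → X.t c' = X.s a →
    (c, a) ∉ X.R → (c', a) ∉ X.R → c = c'

/-! ### The bar resolution and Bardzell's resolution in low degrees -/

/-- `AP₂`, the set of relations. -/
def AP₂ : Type _ := {r : Q₁ × Q₁ // r ∈ X.R}

/-- `AP₃`, the set of triples of arrows with `α₁α₂ = 0 = α₂α₃`. -/
def AP₃ : Type _ := {w : Q₁ × Q₁ × Q₁ // (w.1, w.2.1) ∈ X.R ∧ (w.2.1, w.2.2) ∈ X.R}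

section Complexes

variable (k : Type*) [Field k]

/-- `A ⊗ A`, degree zero of the bar resolution. -/
abbrev Bar₀ : Type _ := X.Alg k ⊗[k] X.Alg k
/-- `A ⊗ A ⊗ A`. -/
abbrev Bar₁ : Type _ := X.Alg k ⊗[k] X.Bar₀ k
/-- `A ⊗ A^{⊗2} ⊗ A`. -/
abbrev Bar₂ : Type _ := X.Alg k ⊗[k] X.Bar₁ k
/-- `A ⊗ A^{⊗3} ⊗ A`. -/
abbrev Bar₃ : Type _ := X.Alg k ⊗[k] X.Bar₂ k

/-- `A ⊗ kΩ ⊗ A`, for a set `Ω` of (supports of) concatenations. -/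
abbrev Bard (Ω : Type*) : Type _ := X.Alg k ⊗[k] ((Ω →₀ k) ⊗[k] X.Alg k)

variable [Fintype Q₀]

section Actions

variable (M : Type*) [AddCommGroup M] [Module k M]

/-- The left action `a ⊗ (b ⊗ m) ↦ ab ⊗ m` of `A` on `A ⊗ M`. -/
def lact : X.Alg k ⊗[k] (X.Alg k ⊗[k] M) →ₗ[k] X.Alg k ⊗[k] M :=
  (LinearMap.mul' k (X.Alg k)).rTensor M ∘ₗ
    (TensorProduct.assoc k (X.Alg k) (X.Alg k) M).symm.toLinearMap

/-- The right action `(m ⊗ a) ⊗ b ↦ m ⊗ ab` of `A` on `M ⊗ A`. -/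
def ract : (M ⊗[k] X.Alg k) ⊗[k] X.Alg k →ₗ[k] M ⊗[k] X.Alg k :=
  (LinearMap.mul' k (X.Alg k)).lTensor M ∘ₗ
    (TensorProduct.assoc k M (X.Alg k) (X.Alg k)).toLinearMap

/-- The bimodule structure `a ⊗ ((b ⊗ m ⊗ c) ⊗ d) ↦ ab ⊗ m ⊗ cd` of `A ⊗ M ⊗ A`. -/
def biact : X.Alg k ⊗[k] ((X.Alg k ⊗[k] (M ⊗[k] X.Alg k)) ⊗[k] X.Alg k) →ₗ[k]
    X.Alg k ⊗[k] (M ⊗[k] X.Alg k) :=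
  X.lact k (M ⊗[k] X.Alg k) ∘ₗ
    (((X.ract k M).lTensor (X.Alg k)) ∘ₗ
      (TensorProduct.assoc k (X.Alg k) (M ⊗[k] X.Alg k) (X.Alg k)).toLinearMap).lTensor (X.Alg k)

end Actions

/-- The bar differential `a ⊗ b ⊗ c ↦ ab ⊗ c - a ⊗ bc`. -/
def d₁ : X.Bar₁ k →ₗ[k] X.Bar₀ k :=
  X.lact k (X.Alg k) - (LinearMap.mul' k (X.Alg k)).lTensor (X.Alg k)

/-- The bar differential `a ⊗ b ⊗ c ⊗ d ↦ ab ⊗ c ⊗ d - a ⊗ bc ⊗ d + a ⊗ b ⊗ cd`. -/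
def d₂ : X.Bar₂ k →ₗ[k] X.Bar₁ k :=
  X.lact k (X.Bar₀ k) - (X.d₁ k).lTensor (X.Alg k)

/-- The contraction `s₀ (x) = 1 ⊗ x`. -/
def s₀ : X.Bar₀ k →ₗ[k] X.Bar₁ k := TensorProduct.mk k (X.Alg k) (X.Bar₀ k) 1

/-- The contraction `s₁ (x) = 1 ⊗ x`. -/
def s₁ : X.Bar₁ k →ₗ[k] X.Bar₂ k := TensorProduct.mk k (X.Alg k) (X.Bar₁ k) 1

/-- The bimodule map `F₁ (1 ⊗ α ⊗ 1) = 1 ⊗ α ⊗ 1`. Since the tensor products of Bardzell's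
resolution are balanced over `E = kQ₀`, the generator `1 ⊗ α ⊗ 1` equals `e ⊗ α ⊗ e'`, where `e` and
`e'` are the trivial paths at the ends of `α`; these are written out here (and in `F₂`, `F₃`). -/
def F₁ : X.Bard k Q₁ →ₗ[k] X.Bar₁ k :=
  X.lact k (X.Bar₀ k) ∘ₗ (TensorProduct.lift (Finsupp.linearCombination k fun α =>
    TensorProduct.mk k (X.Alg k) (X.Bar₀ k) (X.idem k (X.s α)) ∘ₗ
    TensorProduct.mk k (X.Alg k) (X.Alg k) (X.arrow k α) ∘ₗ
    LinearMap.mulLeft k (X.idem k (X.t α)))).lTensor (X.Alg k)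

/-- The bimodule map `F₂ (1 ⊗ (α₁, α₂) ⊗ 1) = 1 ⊗ α₁ ⊗ α₂ ⊗ 1`. -/
def F₂ : X.Bard k X.AP₂ →ₗ[k] X.Bar₂ k :=
  X.lact k (X.Bar₁ k) ∘ₗ (TensorProduct.lift (Finsupp.linearCombination k fun r =>
    TensorProduct.mk k (X.Alg k) (X.Bar₁ k) (X.idem k (X.s r.1.1)) ∘ₗ
    TensorProduct.mk k (X.Alg k) (X.Bar₀ k) (X.arrow k r.1.1) ∘ₗ
    TensorProduct.mk k (X.Alg k) (X.Alg k) (X.arrow k r.1.2) ∘ₗ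
    LinearMap.mulLeft k (X.idem k (X.t r.1.2)))).lTensor (X.Alg k)

/-- The bimodule map `F₃ (1 ⊗ (α₁, α₂, α₃) ⊗ 1) = 1 ⊗ α₁ ⊗ α₂ ⊗ α₃ ⊗ 1`. -/
def F₃ : X.Bard k X.AP₃ →ₗ[k] X.Bar₃ k :=
  X.lact k (X.Bar₂ k) ∘ₗ (TensorProduct.lift (Finsupp.linearCombination k fun w =>
    TensorProduct.mk k (X.Alg k) (X.Bar₂ k) (X.idem k (X.s w.1.1)) ∘ₗ
    TensorProduct.mk k (X.Alg k) (X.Bar₁ k) (X.arrow k w.1.1) ∘ₗ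
    TensorProduct.mk k (X.Alg k) (X.Bar₀ k) (X.arrow k w.1.2.1) ∘ₗ
    TensorProduct.mk k (X.Alg k) (X.Alg k) (X.arrow k w.1.2.2) ∘ₗ
    LinearMap.mulLeft k (X.idem k (X.t w.1.2.2)))).lTensor (X.Alg k)

/-- `G₁ (1 ⊗ β₁⋯βₘ ⊗ 1) = ∑ᵢ β₁⋯βᵢ₋₁ ⊗ βᵢ ⊗ βᵢ₊₁⋯βₘ`. -/
def gen₁ : X.Alg k →ₗ[k] X.Bard k Q₁ :=
  X.onPaths fun p => ∑ i : Fin p.1.2.length,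
    X.path k p.1.1 (p.1.2.take i) ⊗ₜ[k] (Finsupp.single p.1.2[i] (1 : k) ⊗ₜ[k]
      X.path k (X.t p.1.2[i]) (p.1.2.drop (i + 1)))

/-- The bimodule map `G₁`. -/
def G₁ : X.Bar₁ k →ₗ[k] X.Bard k Q₁ :=
  X.biact k (Q₁ →₀ k) ∘ₗ ((X.gen₁ k).rTensor (X.Alg k)).lTensor (X.Alg k)

open Classical in
/-- `G₂ (1 ⊗ uα₁ ⊗ α₂v ⊗ 1)` is `u ⊗ (α₁, α₂) ⊗ v` if `α₁α₂` is a relation, and zero otherwise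
(here `uα₁` and `α₂v` are nonzero paths); it is zero if one of the two paths is trivial. -/
def gen₂ : X.Alg k →ₗ[k] X.Alg k →ₗ[k] X.Bard k X.AP₂ :=
  X.onPaths fun p => X.onPaths fun q =>
    match p.1.2.getLast?, q.1.2 with
    | some a, b :: v =>
      if h : (a, b) ∈ X.R then
        X.path k p.1.1 p.1.2.dropLast ⊗ₜ[k]
          (Finsupp.single (⟨(a, b), h⟩ : X.AP₂) (1 : k) ⊗ₜ[k] X.path k (X.t b) v)
      else 0
    | _, _ => 0

/-- The bimodule map `G₂`. -/
def G₂ : X.Bar₂ k →ₗ[k] X.Bard k X.AP₂ :=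
  X.biact k (X.AP₂ →₀ k) ∘ₗ
    ((TensorProduct.lift (X.gen₂ k)).rTensor (X.Alg k) ∘ₗ
      (TensorProduct.assoc k (X.Alg k) (X.Alg k) (X.Alg k)).symm.toLinearMap).lTensor (X.Alg k)

/-- The homotopy `H₁ = Id ⊗ F₁G₁s₀` (recall that `H₀ = 0`). -/
def H₁ : X.Bar₁ k →ₗ[k] X.Bar₂ k :=
  (X.F₁ k ∘ₗ X.G₁ k ∘ₗ X.s₀ k).lTensor (X.Alg k)

/-- The homotopy `H₂ = Id ⊗ F₂G₂s₁ - Id ⊗ H₁d₂s₁`. -/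
def H₂ : X.Bar₂ k →ₗ[k] X.Bar₃ k :=
  (X.F₂ k ∘ₗ X.G₂ k ∘ₗ X.s₁ k).lTensor (X.Alg k) -
    (X.H₁ k ∘ₗ X.d₂ k ∘ₗ X.s₁ k).lTensor (X.Alg k)

/-! ### Cochains -/

/-- Hochschild cochains `C²(A) = Hom_k(A ⊗ A, A)`, as bilinear maps. -/
abbrev C₂ : Type _ := X.Alg k →ₗ[k] X.Alg k →ₗ[k] X.Alg k

/-- Hochschild cochains `C³(A) = Hom_k(A ⊗ A ⊗ A, A)`, as trilinear maps. -/
abbrev C₃ : Type _ := X.Alg k →ₗ[k] X.Alg k →ₗ[k] X.Alg k →ₗ[k] X.Alg k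

/-- `Hom_{E-E}(kΩ, A)`: maps sending each `ω ∈ Ω` into `e A e'`, with `e` and `e'` the trivial
paths at the source and the target of `ω`. -/
def homEE {Ω : Type*} (src tgt : Ω → Q₀) : Submodule k (Ω → X.Alg k) where
  carrier := {f | ∀ w, X.idem k (src w) * f w * X.idem k (tgt w) = f w}
  add_mem' := fun {f g} hf hg w => by
    simp only [Pi.add_apply, mul_add, add_mul]
    rw [hf w, hg w]
  zero_mem' := fun w => by simp
  smul_mem' := fun c f hf w => by
    simp only [Pi.smul_apply, mul_smul_comm, smul_mul_assoc]
    rw [hf w]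

/-- `B¹(A)[1] = B²(A) = Hom_{E-E}(kAP₂, A)`. -/
abbrev B₂ : Type _ := X.homEE k (fun r : X.AP₂ => X.s r.1.1) (fun r => X.t r.1.2)

/-- `B²(A)[1] = B³(A) = Hom_{E-E}(kAP₃, A)`. -/
abbrev B₃ : Type _ := X.homEE k (fun w : X.AP₃ => X.s w.1.1) (fun w => X.t w.1.2.2)

variable {X k}

variable (X k) in
/-- Turns a map `L : M → Hom(N, A)` into `Hom(A, M) → Hom(A ⊗ N, A)`, `f ↦ (a ⊗ n ↦ L (f a) n)`. -/
def extendHat {M N : Type*} [AddCommGroup M] [Module k M] [AddCommGroup N] [Module k N]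
    (L : M →ₗ[k] N →ₗ[k] X.Alg k) :
    (X.Alg k →ₗ[k] M) →ₗ[k] X.Alg k ⊗[k] N →ₗ[k] X.Alg k :=
  (TensorProduct.lift.equiv (.id k) (X.Alg k) N (X.Alg k)).toLinearMap ∘ₗ L.compRight k

/-- The bimodule map `A ⊗ A^{⊗3} ⊗ A → A`, `a ⊗ x ⊗ y ⊗ z ⊗ b ↦ a v(x, y, z) b`, of a cochain `v`. -/
def hat₃ (v : X.C₃ k) : X.Bar₃ k →ₗ[k] X.Alg k :=
  LinearMap.mul' k (X.Alg k) ∘ₗ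
    (X.extendHat k (X.extendHat k (X.extendHat k (LinearMap.mul k (X.Alg k)))) v).lTensor (X.Alg k)

theorem hat₃_tmul (v : X.C₃ k) (a x y z b : X.Alg k) :
    hat₃ v (a ⊗ₜ (x ⊗ₜ (y ⊗ₜ (z ⊗ₜ b)))) = a * (v x y z * b) := rfl

/-- The bimodule map `A ⊗ kAP₂ ⊗ A → A`, `a ⊗ ω ⊗ b ↦ a f(ω) b`. -/
def hatB (f : X.B₂ k) : X.Bard k X.AP₂ →ₗ[k] X.Alg k :=
  LinearMap.mul' k (X.Alg k) ∘ₗ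
    (TensorProduct.lift (Finsupp.linearCombination k fun w =>
      LinearMap.mulLeft k (f.1 w))).lTensor (X.Alg k)

theorem hatB_tmul (f : X.B₂ k) (a b : X.Alg k) (w : X.AP₂) :
    hatB f (a ⊗ₜ (Finsupp.single w (1 : k) ⊗ₜ b)) = a * (f.1 w * b) := by
  simp [hatB]

variable (X k) in
/-- `(x, y) ↦ 1 ⊗ x ⊗ y ⊗ 1`. -/
def ins : X.Alg k →ₗ[k] X.Alg k →ₗ[k] X.Bar₂ k :=
  LinearMap.mk₂ k (fun x y => 1 ⊗ₜ (x ⊗ₜ (y ⊗ₜ 1)))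
    (fun x x' y => by simp only [TensorProduct.add_tmul, TensorProduct.tmul_add])
    (fun c x y => by simp only [← TensorProduct.smul_tmul', TensorProduct.tmul_smul])
    (fun x y y' => by simp only [TensorProduct.add_tmul, TensorProduct.tmul_add])
    (fun c x y => by simp only [← TensorProduct.smul_tmul', TensorProduct.tmul_smul])

/-- `G^* : B²(A) → C²(A)`, `(G^* f)(x, y) = f̂ (G₂ (1 ⊗ x ⊗ y ⊗ 1))`. -/
def Gstar (f : X.B₂ k) : X.C₂ k := (X.ins k).compr₂ (hatB f ∘ₗ X.G₂ k)

/-- `H^* : C³(A) → C²(A)`, `(H^* v)(x, y) = v̂ (H₂ (1 ⊗ x ⊗ y ⊗ 1))`. -/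
def Hstar (v : X.C₃ k) : X.C₂ k := (X.ins k).compr₂ (hat₃ v ∘ₗ X.H₂ k)

theorem hat₃_F₃ (v : X.C₃ k) (w : X.AP₃) :
    hat₃ v (X.F₃ k (1 ⊗ₜ (Finsupp.single w (1 : k) ⊗ₜ 1))) =
      X.idem k (X.s w.1.1) *
        (v (X.arrow k w.1.1) (X.arrow k w.1.2.1) (X.arrow k w.1.2.2) *
          X.idem k (X.t w.1.2.2)) := by
  simp [F₃, lact, hat₃_tmul]

/-- `F^* : C³(A) → B³(A)`, `(F^* v)(ω) = v̂ (F₃ (1 ⊗ ω ⊗ 1))`. -/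
def Fstar (v : X.C₃ k) : X.B₃ k :=
  ⟨fun w => hat₃ v (X.F₃ k (1 ⊗ₜ (Finsupp.single w (1 : k) ⊗ₜ 1))), fun w => by
    simp only [hat₃_F₃]
    rw [← mul_assoc, idem_mul_idem, mul_assoc, mul_assoc, idem_mul_idem]⟩

/-- The Gerstenhaber product `f ∘ g = f(g ⊗ Id - Id ⊗ g)` of two elements of `C²(A)`. -/
def circ (f g : X.C₂ k) : X.C₃ k :=
  (LinearMap.llcomp k (X.Alg k) (X.Alg k) (X.Alg k →ₗ[k] X.Alg k) f) ∘ₗ g -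
  (LinearMap.lcomp k (X.Alg k →ₗ[k] X.Alg k) g ∘ₗ
    LinearMap.llcomp k (X.Alg k) (X.Alg k) (X.Alg k)) ∘ₗ f

theorem circ_apply (f g : X.C₂ k) (x y z : X.Alg k) :
    circ f g x y z = f (g x y) z - f x (g y z) := rfl

/-- The Gerstenhaber bracket `[f, g] = f ∘ g + g ∘ f` of two elements of `C²(A)`. -/
def gerst (f g : X.C₂ k) : X.C₃ k := circ f g + circ g f

/-! ### The brackets `lₙ`

The maps `vₙ`, `φₙ`, `lₙ` are needed on elements `f₁, …, fₙ ∈ B¹(A)[1]` only. These have degree one,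
so that `φₜ(f₁, …, fₜ)` has degree one and lies in `C²(A)`, and `vₙ(f₁, …, fₙ)` has degree two and
lies in `C³(A)`; hence the recursion closes up on such elements.

A `(t, n - t)`-shuffle `τ` is encoded by the set `T = {τ(1), …, τ(t)}`; it belongs to
`𝕊⁻_{t, n-t}` if `τ(1) < τ(t + 1)`, that is, if `T` contains the least index. On elements of degree
one the antisymmetric Koszul sign is `χ(τ) = sgn(τ) sgn(τ) = 1`, and the sign
`κ(τ)ₜ = (-1)^{(t - 1) + (n - t - 1)(|f_{τ(1)}| + ⋯ + |f_{τ(t)}|)}` depends on `t` and `n` only. -/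

variable (k) in
/-- The sign `κ(τ)ₜ` for a `(t, n - t)`-shuffle of elements of degree one. -/
def kappa (t n : ℕ) : k := (-1) ^ ((t - 1) + (n - t - 1) * t)

/-- The proper nonempty subsets of `S` that contain the least element of `S`. -/
abbrev Split {n : ℕ} (S : Finset (Fin n)) : Type :=
  {T : Finset (Fin n) // T ⊂ S ∧ ∃ i ∈ T, ∀ j ∈ S, i ≤ j}

open Classical in
/-- `φ_t(f_{i₁}, …, f_{i_t})`, where `S = {i₁ < ⋯ < i_t}`:
`φ₁ = G^*`, and `φ_t = H^* v_t` for `t ≥ 2`. -/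
def phi {n : ℕ} (f : Fin n → X.B₂ k) (S : Finset (Fin n)) : X.C₂ k :=
  if S.card = 1 then ∑ i ∈ S, Gstar (f i)
  else Hstar (∑ T : Split S,
    kappa k T.1.card S.card • gerst (phi f T.1) (phi f (S \ T.1)))
termination_by S.card
decreasing_by
  · exact Finset.card_lt_card T.2.1
  · obtain ⟨i, hi, -⟩ := T.2.2
    exact Finset.card_lt_card (Finset.sdiff_ssubset T.2.1.1 ⟨i, hi⟩)

open Classical in
/-- `v_t(f_{i₁}, …, f_{i_t})`, where `S = {i₁ < ⋯ < i_t}`: the sum of the terms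
`χ(τ) κ(τ) [φ_r, φ_{t-r}] τ̂`. -/
def vee {n : ℕ} (f : Fin n → X.B₂ k) (S : Finset (Fin n)) : X.C₃ k :=
  ∑ T : Split S, kappa k T.1.card S.card • gerst (phi f T.1) (phi f (S \ T.1))

theorem phi_of_card_eq_one {n : ℕ} (f : Fin n → X.B₂ k) (i : Fin n) :
    phi f {i} = Gstar (f i) := by
  rw [phi]
  simp

theorem phi_of_card_ne_one {n : ℕ} (f : Fin n → X.B₂ k) (S : Finset (Fin n)) (h : S.card ≠ 1) :
    phi f S = Hstar (vee f S) := by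
  rw [phi, if_neg h, vee]

/-- `l₁ = -δ²` on `B¹(A)[1]`: `l₁(f)(α₁, α₂, α₃) = f(α₁α₂)α₃ - α₁f(α₂α₃)`. -/
def lOne (f : X.B₂ k) : X.B₃ k :=
  ⟨fun w => f.1 ⟨(w.1.1, w.1.2.1), w.2.1⟩ * X.arrow k w.1.2.2 -
      X.arrow k w.1.1 * f.1 ⟨(w.1.2.1, w.1.2.2), w.2.2⟩, fun w => by
    have h1 := f.2 ⟨(w.1.1, w.1.2.1), w.2.1⟩
    have h2 := f.2 ⟨(w.1.2.1, w.1.2.2), w.2.2⟩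
    rw [mul_sub, sub_mul, mul_assoc, mul_assoc _ (X.arrow k w.1.2.2), arrow_mul_idem,
      ← mul_assoc, ← mul_assoc _ (X.arrow k w.1.1), idem_mul_arrow, mul_assoc (X.arrow k w.1.1)]
    congr 2
    · rw [← h1]
      simp only [← mul_assoc, idem_mul_idem]
    · rw [← h2]
      simp only [mul_assoc, idem_mul_idem]⟩

/-- The bracket `lₙ(f₁, …, fₙ) ∈ B²(A)[1]` of elements of `B¹(A)[1]`, for `n ≥ 1`:
`l₁ = -δ²`, and `lₙ = F^* vₙ` for `n ≥ 2`. -/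
def bracket : (n : ℕ) → (Fin n → X.B₂ k) → X.B₃ k
  | 0, _ => 0
  | 1, f => lOne (f 0)
  | _ + 2, f => Fstar (vee f Finset.univ)

end Complexes

/-! ### The configuration -/

/-- A subquiver of `Q` of the form
```
               5 --ρ--> 6
           γ₁ ↗  ↘ γ₂  ↗ δ₁ ⋱ δ₂⋯δₛ
   1 --α₁--> 2 --α₂--> 3 --α₃--> 4
   1 ⋯⋯v'⋯⋯> 2
```
(`γ₁ : 2 → 5`, `γ₂ : 5 → 3`, `ρ : 5 → 6`, `δ₁ : 3 → 6`, `δ₂⋯δₛ` a path from `6` to `4`, and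
`v' = β₁⋯βₘ` a path from `1` to `2`, `m ≥ 1`, `s ≥ 2`; all its vertices and all its arrows are
distinct), such that `α₁α₂ = 0 = α₂α₃` and `v'`, `γ₁γ₂`, `w' = δ₁δ₂⋯δₛ` are nonzero. -/
structure StarConfig where
  α₁ : Q₁
  α₂ : Q₁
  α₃ : Q₁
  γ₁ : Q₁
  γ₂ : Q₁
  ρ : Q₁
  δ₁ : Q₁
  δ : List Q₁
  β : List Q₁
  rel₁₂ : (α₁, α₂) ∈ X.R
  rel₂₃ : (α₂, α₃) ∈ X.R
  source_γ₁ : X.s γ₁ = X.s α₂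
  nonzero_γ : X.IsNonzeroPath (X.s γ₁) [γ₁, γ₂]
  target_γ₂ : X.t γ₂ = X.t α₂
  source_ρ : X.s ρ = X.t γ₁
  target_ρ : X.t ρ = X.t δ₁
  δ_ne_nil : δ ≠ []
  nonzero_w : X.IsNonzeroPath (X.s α₃) (δ₁ :: δ)
  target_w : X.target (X.s α₃) (δ₁ :: δ) = X.t α₃
  β_ne_nil : β ≠ []
  nonzero_v : X.IsNonzeroPath (X.s α₁) β
  target_v : X.target (X.s α₁) β = X.t α₁
  arrows_nodup : ([α₁, α₂, α₃, γ₁, γ₂, ρ, δ₁] ++ β ++ δ).Nodup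
  vertices_nodup : ([X.s α₁, X.s α₂, X.s α₃, X.t α₃, X.t γ₁, X.t δ₁] ++
    β.dropLast.map X.t ++ δ.dropLast.map X.t).Nodup

namespace StarConfig

variable {X} (S : X.StarConfig) (k : Type*) [Field k]

/-- `ω = (α₁, α₂, α₃) ∈ AP₃`. -/
def omega : X.AP₃ := ⟨(S.α₁, S.α₂, S.α₃), S.rel₁₂, S.rel₂₃⟩

/-- The path `v'α₂w'` in `A`. -/
def bigPath : X.Alg k := X.path k (X.s S.α₁) (S.β ++ [S.α₂] ++ (S.δ₁ :: S.δ))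

open Classical in
/-- The values on relations of the cochain
`(α₁α₂ || v'α₂ + α₁γ₁γ₂) + (α₂α₃ || γ₁γ₂α₃ + α₂w') + (γ₂δ₁ || ρ) + (γ₁ρ || α₂δ₁)`. -/
def value (r : Q₁ × Q₁) : X.Alg k :=
  if r = (S.α₁, S.α₂) then
    X.path k (X.s S.α₁) (S.β ++ [S.α₂]) + X.path k (X.s S.α₁) [S.α₁, S.γ₁, S.γ₂]
  else if r = (S.α₂, S.α₃) then
    X.path k (X.s S.α₂) [S.γ₁, S.γ₂, S.α₃] + X.path k (X.s S.α₂) (S.α₂ :: S.δ₁ :: S.δ)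
  else if r = (S.γ₂, S.δ₁) then X.path k (X.s S.γ₂) [S.ρ]
  else if r = (S.γ₁, S.ρ) then X.path k (X.s S.γ₁) [S.α₂, S.δ₁]
  else 0

end StarConfig

end BoundQuiver

end

open scoped TensorProduct

noncomputable section

namespace BoundQuiver

section

variable {Q₀ Q₁ : Type*} {X : BoundQuiver Q₀ Q₁} {k : Type*} [Field k]

/-! ### Evaluation of the transfer maps on paths -/

/-! On a constant family the brackets become a Maurer–Cartan recursion. Up to a factor ± n!,
φₙ(f,…,f) is the term ψₙ given by ψ₁ = G^*f and ψₙ = -H^*(∑ ψᵢ∘ψₙ₋ᵢ), and lₙ(f,…,f) is F^* of the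
curvature ∑ ψᵢ∘ψₙ₋ᵢ (`phi_const`, `bracket_const`). The number of shuffles of each type is a
binomial coefficient, absorbed by the factorials; the signs are absorbed by (-1)^{n(n-1)/2}.

All ψₙ vanish on trivial paths, so most of H₂ disappears and ψ is computed by rewriting paths. If ac
is a relation, then ψₙ₊₁(ua, c) = ψₙ(u, f(ac)) for n ≥ 1, up to the idempotent at the end of c
(`psi_path_arrow`). If xy is a nonzero path, then ψₙ(x, y) = 0 (`psi_path_path_eq_zero`). A value
can be prolonged to the right as long as it stays a nonzero path (`psi_path_append`).

The terms (γ₂δ₁‖ρ) and (γ₁ρ‖α₂δ₁) of f close a loop: ψₙ₊₃(α₁, α₂δ₁) = ψₙ₊₂(α₁γ₁γ₂, δ₁) = ψₙ₊₁(α₁γ₁,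
ρ) = ψₙ(α₁, α₂δ₁). It is fed only by ψ₁(α₁, α₂δ₁) = v'α₂δ₁, so ψₙ(α₁, α₂δ₁) is v'α₂δ₁ for n ≡ 1 mod
3 and zero otherwise (`psi_α₁_α₂_δ₁`). Prolonging by δ₂⋯δₛ gives ψₙ(α₁, α₂w'). The curvature at ω in
degree n + 1 is ψₙ(f(α₁α₂), α₃) - ψₙ(α₁, f(α₂α₃)); for n = 3j + 1 with j ≥ 1 only -ψₙ(α₁, α₂w') =
-v'α₂w' survives (`curv_omega`). In characteristic zero the factor n! does not kill it. -/

theorem target_append_singleton (v : Q₀) (u : List Q₁) (a : Q₁) :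
    X.target v (u ++ [a]) = X.t a := by
  rw [target_append]
  rfl

theorem IsNonzeroPath.target_eq_source {v : Q₀} {u m : List Q₁} {a : Q₁}
    (h : X.IsNonzeroPath v (u ++ a :: m)) : X.target v u = X.s a :=
  h.of_append.2.1.1.symm

theorem arrow_isNonzeroPath (a : Q₁) : X.IsNonzeroPath (X.s a) [a] :=
  ⟨⟨rfl, trivial⟩, List.isChain_singleton a⟩

theorem nil_isNonzeroPath (v : Q₀) : X.IsNonzeroPath v [] := ⟨trivial, List.isChain_nil⟩

/-- The product of a path with an arrow starting at its end. -/
theorem path_mul_arrow {v : Q₀} {u : List Q₁} {a : Q₁} (h : X.target v u = X.s a) :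
    X.path k v u * X.arrow k a = X.path k v (u ++ [a]) := by
  rw [arrow, path_mul_path, if_pos h]

theorem path_mul_idem {v w : Q₀} {u : List Q₁} (h : X.target v u = w) :
    X.path k v u * X.idem k w = X.path k v u := by
  rw [idem, path_mul_path, if_pos h, List.append_nil]

theorem idem_mul_path (v : Q₀) (u : List Q₁) :
    X.idem k v * X.path k v u = X.path k v u := by
  rw [idem, path_mul_path, List.nil_append]
  exact if_pos rfl

variable [Fintype Q₀]

theorem gen₁_path {v : Q₀} {l : List Q₁} (h : X.IsNonzeroPath v l) :
    X.gen₁ k (X.path k v l) = ∑ i : Fin l.length,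
      X.path k v (l.take i) ⊗ₜ[k] (Finsupp.single l[i] (1 : k) ⊗ₜ[k]
        X.path k (X.t l[i]) (l.drop (i + 1))) :=
  onPaths_path k _ h

/-- A relation, as an element of `AP₂`. -/
def toAP₂ {a c : Q₁} (h : (a, c) ∈ X.R) : X.AP₂ := ⟨(a, c), h⟩

theorem gen₂_of_mem {v w : Q₀} {u m : List Q₁} {a c : Q₁}
    (hx : X.IsNonzeroPath v (u ++ [a])) (hy : X.IsNonzeroPath w (c :: m)) (h : (a, c) ∈ X.R) :
    X.gen₂ k (X.path k v (u ++ [a])) (X.path k w (c :: m)) =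
      X.path k v u ⊗ₜ[k] (Finsupp.single (toAP₂ h) (1 : k) ⊗ₜ[k] X.path k (X.t c) m) := by
  rw [gen₂, onPaths_path k _ hx, onPaths_path k _ hy]
  simp only [List.getLast?_append, List.getLast?_singleton, Option.some_or, List.dropLast_concat]
  exact dif_pos h

theorem gen₂_of_notMem {v w : Q₀} {u m : List Q₁} {a c : Q₁}
    (hx : X.IsNonzeroPath v (u ++ [a])) (hy : X.IsNonzeroPath w (c :: m)) (h : (a, c) ∉ X.R) :
    X.gen₂ k (X.path k v (u ++ [a])) (X.path k w (c :: m)) = 0 := by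
  rw [gen₂, onPaths_path k _ hx, onPaths_path k _ hy]
  simp only [List.getLast?_append, List.getLast?_singleton, Option.some_or, List.dropLast_concat]
  exact dif_neg h

theorem gen₂_idem_left (v : Q₀) (y : X.Alg k) : X.gen₂ k (X.idem k v) y = 0 := by
  suffices h : X.gen₂ k (X.idem k v) = 0 by rw [h, LinearMap.zero_apply]
  refine alg_hom_ext k fun w m hm => ?_
  rw [gen₂, idem, onPaths_path k _ (nil_isNonzeroPath v), onPaths_path k _ hm]
  rfl

theorem gen₂_idem_right (x : X.Alg k) (w : Q₀) : X.gen₂ k x (X.idem k w) = 0 := by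
  suffices h : (X.gen₂ k).flip (X.idem k w) = 0 from LinearMap.congr_fun h x
  refine alg_hom_ext k fun v l hl => ?_
  rw [LinearMap.flip_apply, gen₂, idem, onPaths_path k _ hl, onPaths_path k _ (nil_isNonzeroPath w)]
  dsimp only
  split <;> simp_all

theorem lact_tmul (M : Type*) [AddCommGroup M] [Module k M] (a b : X.Alg k) (m : M) :
    X.lact k M (a ⊗ₜ (b ⊗ₜ m)) = (a * b) ⊗ₜ m := rfl

theorem biact_tmul (M : Type*) [AddCommGroup M] [Module k M] (a b c d : X.Alg k)
    (m : M) :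
    X.biact k M (a ⊗ₜ ((b ⊗ₜ (m ⊗ₜ c)) ⊗ₜ d)) = (a * b) ⊗ₜ (m ⊗ₜ (c * d)) := rfl

theorem biact_one_tmul_one (M : Type*) [AddCommGroup M] [Module k M]
    (z : X.Alg k ⊗[k] (M ⊗[k] X.Alg k)) : X.biact k M (1 ⊗ₜ (z ⊗ₜ 1)) = z := by
  induction z with
  | zero => simp
  | add z z' h h' => rw [TensorProduct.add_tmul, TensorProduct.tmul_add, map_add, h, h']
  | tmul b y =>
    induction y with
    | zero => simp
    | add y y' h h' =>
      rw [TensorProduct.tmul_add, TensorProduct.add_tmul, TensorProduct.tmul_add, map_add, h, h']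
    | tmul m c => rw [biact_tmul, one_mul, mul_one]

theorem G₂_ins (x y : X.Alg k) : X.G₂ k (X.ins k x y) = X.gen₂ k x y :=
  biact_one_tmul_one _ _

theorem F₁_tmul (a b : X.Alg k) (c : Q₁) :
    X.F₁ k (a ⊗ₜ (Finsupp.single c (1 : k) ⊗ₜ b)) =
      (a * X.idem k (X.s c)) ⊗ₜ (X.arrow k c ⊗ₜ (X.idem k (X.t c) * b)) := by
  simp [F₁, lact_tmul]

theorem F₂_tmul (a b : X.Alg k) (r : X.AP₂) :
    X.F₂ k (a ⊗ₜ (Finsupp.single r (1 : k) ⊗ₜ b)) =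
      (a * X.idem k (X.s r.1.1)) ⊗ₜ (X.arrow k r.1.1 ⊗ₜ (X.arrow k r.1.2 ⊗ₜ
        (X.idem k (X.t r.1.2) * b))) := by
  simp [F₂, lact_tmul]

theorem Gstar_apply (f : X.B₂ k) (x y : X.Alg k) : Gstar f x y = hatB f (X.gen₂ k x y) := by
  rw [← G₂_ins]
  rfl

/-- The summand `v̂ (1 ⊗ F₂G₂ (1 ⊗ x ⊗ y ⊗ 1))` of `(H^* v)(x, y)`. -/
def relationPart (v : X.C₃ k) (x y : X.Alg k) : X.Alg k :=
  hat₃ v (1 ⊗ₜ X.F₂ k (X.gen₂ k x y))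

/-- The summand `v̂ (1 ⊗ H₁ (a ⊗ x ⊗ b))` of `(H^* v)(x, y)`. -/
def splitPart (v : X.C₃ k) (a x b : X.Alg k) : X.Alg k :=
  hat₃ v (1 ⊗ₜ X.H₁ k (a ⊗ₜ (x ⊗ₜ b)))

/-- The three split parts come from the three terms of the bar differential of 1 ⊗ x ⊗ y ⊗ 1. -/
theorem Hstar_apply (v : X.C₃ k) (x y : X.Alg k) :
    Hstar v x y = relationPart v x y -
      (splitPart v x y 1 - (splitPart v 1 (x * y) 1 - splitPart v 1 x y)) := by
  have h : X.H₂ k (X.ins k x y) = 1 ⊗ₜ X.F₂ k (X.G₂ k (X.ins k x y)) -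
      1 ⊗ₜ X.H₁ k (X.d₂ k (X.ins k x y)) := rfl
  have hd : X.d₂ k (X.ins k x y) = (1 * x) ⊗ₜ (y ⊗ₜ 1) -
      1 ⊗ₜ ((x * y) ⊗ₜ 1 - x ⊗ₜ (y * 1)) := rfl
  have h' : Hstar v x y = hat₃ v (X.H₂ k (X.ins k x y)) := rfl
  rw [h', h, hd, G₂_ins, one_mul, mul_one]
  simp only [map_sub, TensorProduct.tmul_sub, relationPart, splitPart]

theorem splitPart_path (v : X.C₃ k) (a b : X.Alg k) {w : Q₀} {l : List Q₁}
    (h : X.IsNonzeroPath w l) :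
    splitPart v a (X.path k w l) b = ∑ i : Fin l.length,
      v a (X.path k w (l.take i)) (X.arrow k l[i]) *
        (X.path k (X.t l[i]) (l.drop (i + 1)) * b) := by
  have h1 : X.H₁ k (a ⊗ₜ (X.path k w l ⊗ₜ b)) =
      a ⊗ₜ X.F₁ k (X.biact k (Q₁ →₀ k) (1 ⊗ₜ (X.gen₁ k (X.path k w l) ⊗ₜ b))) := rfl
  rw [splitPart, h1, gen₁_path h, TensorProduct.sum_tmul, TensorProduct.tmul_sum, map_sum, map_sum,
    TensorProduct.tmul_sum, TensorProduct.tmul_sum, map_sum]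
  refine Finset.sum_congr rfl fun i _ => ?_
  rw [biact_tmul, F₁_tmul, hat₃_tmul, one_mul, one_mul, ← mul_assoc (X.idem k _), idem_mul_path,
    path_mul_idem]
  have e : l = l.take i ++ l[i] :: l.drop (i + 1) := by
    simp
  rw [e] at h
  exact h.target_eq_source

theorem sum_split_append_singleton {α M : Type*} [AddCommMonoid M] (F : List α → α → List α → M)
    (l : List α) (c : α) :
    ∑ i : Fin (l ++ [c]).length, F ((l ++ [c]).take i) (l ++ [c])[i] ((l ++ [c]).drop (i + 1)) =
      ∑ i : Fin l.length, F (l.take i) l[i] (l.drop (i + 1) ++ [c]) + F l c [] := by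
  have e : (l ++ [c]).length = l.length + 1 := by simp
  refine (Fintype.sum_equiv (finCongr e) _ (fun i : Fin (l.length + 1) =>
    F ((l ++ [c]).take i) ((l ++ [c])[i.1]'(by rw [e]; exact i.2)) ((l ++ [c]).drop (i + 1)))
    (fun i => rfl)).trans ?_
  rw [Fin.sum_univ_castSucc]
  congr 1
  · refine Finset.sum_congr rfl fun i _ => ?_
    have hi := i.2
    simp [List.take_append_of_le_length hi.le, List.drop_append_of_le_length hi]
  · simp

/-- The cuts in G₁ of the path mc are those of m, multiplied by c on the right, and one new cut at
c. -/
theorem splitPart_append_singleton (v : X.C₃ k) (x : X.Alg k) {w : Q₀} {m : List Q₁} {c : Q₁}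
    (h : X.IsNonzeroPath w (m ++ [c])) :
    splitPart v x (X.path k w (m ++ [c])) 1 =
      splitPart v x (X.path k w m) 1 * X.arrow k c +
        v x (X.path k w m) (X.arrow k c) * X.idem k (X.t c) := by
  rw [splitPart_path v x 1 h, splitPart_path v x 1 h.of_append.1, Finset.sum_mul,
    sum_split_append_singleton (fun p a q => v x (X.path k w p) (X.arrow k a) *
      (X.path k (X.t a) q * 1))]
  simp only [mul_one, mul_assoc]
  congr 1
  refine Finset.sum_congr rfl fun i _ => ?_
  rw [path_mul_arrow]
  have e : m = m.take i ++ [m[i]] ++ m.drop (i + 1) := by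
    simp
  have h' := h.target_eq_source
  rwa [e, target_append, target_append_singleton] at h'

theorem splitPart_idem (v : X.C₃ k) (a b : X.Alg k) (w : Q₀) :
    splitPart v a (X.idem k w) b = 0 := by
  rw [idem, splitPart_path v a b (nil_isNonzeroPath w)]
  exact Fin.sum_univ_zero _

/-- H₁ = Id ⊗ F₁G₁s₀ leaves its first factor untouched, and this factor becomes the first argument
of v. -/
theorem splitPart_eq_zero {v : X.C₃ k} {a : X.Alg k} (ha : v a = 0) (x b : X.Alg k) :
    splitPart v a x b = 0 := by
  have h : splitPart v a x b = 1 * X.extendHat k (X.extendHat k (LinearMap.mul k (X.Alg k))) (v a)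
      (X.F₁ k (X.G₁ k (X.s₀ k (x ⊗ₜ b)))) := rfl
  rw [h, ha, map_zero, LinearMap.zero_apply, mul_zero]

theorem relationPart_idem_left (v : X.C₃ k) (w : Q₀) (y : X.Alg k) :
    relationPart v (X.idem k w) y = 0 := by
  rw [relationPart, gen₂_idem_left, map_zero, TensorProduct.tmul_zero, map_zero]

theorem relationPart_idem_right (v : X.C₃ k) (x : X.Alg k) (w : Q₀) :
    relationPart v x (X.idem k w) = 0 := by
  rw [relationPart, gen₂_idem_right, map_zero, TensorProduct.tmul_zero, map_zero]

open Classical in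
theorem relationPart_path_path (v : X.C₃ k) {p w : Q₀} {u m : List Q₁} {a c : Q₁}
    (hx : X.IsNonzeroPath p (u ++ [a])) (hy : X.IsNonzeroPath w (c :: m)) :
    relationPart v (X.path k p (u ++ [a])) (X.path k w (c :: m)) =
      if (a, c) ∈ X.R then
        v (X.path k p u) (X.arrow k a) (X.arrow k c) * X.path k (X.t c) m
      else 0 := by
  rw [relationPart]
  split_ifs with h
  · rw [gen₂_of_mem hx hy h, F₂_tmul, hat₃_tmul, one_mul]
    change v (X.path k p u * X.idem k (X.s a)) (X.arrow k a) (X.arrow k c) *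
      (X.idem k (X.t c) * X.path k (X.t c) m) = _
    rw [idem_mul_path, path_mul_idem hx.target_eq_source]
  · rw [gen₂_of_notMem hx hy h, map_zero, TensorProduct.tmul_zero, map_zero]

open Classical in
theorem Gstar_path_path (f : X.B₂ k) {p w : Q₀} {u m : List Q₁} {a c : Q₁}
    (hx : X.IsNonzeroPath p (u ++ [a])) (hy : X.IsNonzeroPath w (c :: m)) :
    Gstar f (X.path k p (u ++ [a])) (X.path k w (c :: m)) =
      if h : (a, c) ∈ X.R then X.path k p u * (f.1 (toAP₂ h) * X.path k (X.t c) m) else 0 := by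
  rw [Gstar_apply]
  split_ifs with h
  · rw [gen₂_of_mem hx hy h, hatB_tmul]
  · rw [gen₂_of_notMem hx hy h, map_zero]

/-- A cochain in `C³(A)` that vanishes if its first or its second argument is a trivial path. -/
structure IsNormalized₃ (v : X.C₃ k) : Prop where
  left : ∀ w, v (X.idem k w) = 0
  middle : ∀ x w, v x (X.idem k w) = 0

theorem IsNormalized₃.one {v : X.C₃ k} (hv : IsNormalized₃ v) : v 1 = 0 := by
  change v (∑ w, X.idem k w) = 0
  rw [map_sum]
  exact Finset.sum_eq_zero fun w _ => hv.left w

/-- Two of the three split parts have first argument 1, a sum of trivial paths. -/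
theorem IsNormalized₃.Hstar_apply {v : X.C₃ k} (hv : IsNormalized₃ v) (x y : X.Alg k) :
    Hstar v x y = relationPart v x y - splitPart v x y 1 := by
  rw [BoundQuiver.Hstar_apply, splitPart_eq_zero hv.one, splitPart_eq_zero hv.one, sub_zero,
    sub_zero]

/-- A cochain in `C²(A)` that vanishes on trivial paths. -/
structure IsNormalized₂ (g : X.C₂ k) : Prop where
  left : ∀ w, g (X.idem k w) = 0
  right : ∀ x w, g x (X.idem k w) = 0

theorem isNormalized₂_Gstar (f : X.B₂ k) : IsNormalized₂ (Gstar f) where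
  left w := LinearMap.ext fun y => by rw [Gstar_apply, gen₂_idem_left, map_zero]; rfl
  right x w := by rw [Gstar_apply, gen₂_idem_right, map_zero]

theorem IsNormalized₃.isNormalized₂_Hstar {v : X.C₃ k} (hv : IsNormalized₃ v) :
    IsNormalized₂ (Hstar v) where
  left w := LinearMap.ext fun y => by
    rw [hv.Hstar_apply, relationPart_idem_left, splitPart_eq_zero (hv.left w), sub_zero]
    rfl
  right x w := by rw [hv.Hstar_apply, relationPart_idem_right, splitPart_idem, sub_zero]

theorem IsNormalized₂.circ {g h : X.C₂ k} (hg : IsNormalized₂ g) (hh : IsNormalized₂ h) :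
    IsNormalized₃ (circ g h) where
  left w := by
    ext y z
    simp [circ_apply, hh.left, hg.left]
  middle x w := by
    ext z
    simp [circ_apply, hh.left, hh.right]

open Classical in
/-- `H^*` on a path followed by an arrow. -/
theorem IsNormalized₃.Hstar_arrow {v : X.C₃ k} (hv : IsNormalized₃ v) {p : Q₀} {u : List Q₁}
    {a : Q₁} (hx : X.IsNonzeroPath p (u ++ [a])) (c : Q₁) :
    Hstar v (X.path k p (u ++ [a])) (X.arrow k c) =
      if (a, c) ∈ X.R then
        v (X.path k p u) (X.arrow k a) (X.arrow k c) * X.idem k (X.t c)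
      else 0 := by
  -- An arrow has a single cut, with a trivial path to its left; this path fills the middle argument
  -- of v, so the split part vanishes.
  have h1 := splitPart_append_singleton v (X.path k p (u ++ [a])) (m := [])
    (arrow_isNonzeroPath c)
  rw [← idem, splitPart_idem, zero_mul, hv.middle, LinearMap.zero_apply, zero_mul, add_zero] at h1
  rw [hv.Hstar_apply, arrow, relationPart_path_path v hx (arrow_isNonzeroPath c)]
  rw [List.nil_append] at h1
  rw [h1, sub_zero]
  rfl

/-- G₂ sees only the first arrow of its second path, so for m nonempty the relation part is just
multiplied by c. The correction is the new cut of G₁ at c. -/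
theorem IsNormalized₃.Hstar_append_singleton {v : X.C₃ k} (hv : IsNormalized₃ v) {p w : Q₀}
    {l m : List Q₁} {c : Q₁} (hx : X.IsNonzeroPath p l) (hm : m ≠ [])
    (hy : X.IsNonzeroPath w (m ++ [c])) :
    Hstar v (X.path k p l) (X.path k w (m ++ [c])) =
      Hstar v (X.path k p l) (X.path k w m) * X.arrow k c -
        v (X.path k p l) (X.path k w m) (X.arrow k c) * X.idem k (X.t c) := by
  rw [hv.Hstar_apply, hv.Hstar_apply, splitPart_append_singleton v _ hy, sub_mul, sub_sub]
  congr 1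
  rcases List.eq_nil_or_concat' l with rfl | ⟨u, a, rfl⟩
  · rw [← idem, relationPart_idem_left, relationPart_idem_left, zero_mul]
  · obtain ⟨b, m, rfl⟩ := List.exists_cons_of_ne_nil hm
    rw [List.cons_append, relationPart_path_path v hx (m := m ++ [c]) hy,
      relationPart_path_path v hx hy.of_append.1]
    split_ifs
    · rw [mul_assoc, path_mul_arrow]
      exact hy.target_eq_source
    · rw [zero_mul]

theorem Gstar_append_singleton (f : X.B₂ k) {p w : Q₀}
    {l m : List Q₁} {c : Q₁} (hx : X.IsNonzeroPath p l) (hm : m ≠ [])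
    (hy : X.IsNonzeroPath w (m ++ [c])) :
    Gstar f (X.path k p l) (X.path k w (m ++ [c])) =
      Gstar f (X.path k p l) (X.path k w m) * X.arrow k c := by
  rcases List.eq_nil_or_concat' l with rfl | ⟨u, a, rfl⟩
  · rw [← idem, (isNormalized₂_Gstar f).left, LinearMap.zero_apply, LinearMap.zero_apply, zero_mul]
  · obtain ⟨b, m, rfl⟩ := List.exists_cons_of_ne_nil hm
    rw [List.cons_append, Gstar_path_path f hx (m := m ++ [c]) hy,
      Gstar_path_path f hx hy.of_append.1]
    split_ifs
    · rw [mul_assoc, mul_assoc, path_mul_arrow]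
      exact hy.target_eq_source
    · rw [zero_mul]

end

section

variable {Q₀ Q₁ : Type*} {X : BoundQuiver Q₀ Q₁} {k : Type*} [Field k] [Fintype Q₀]

/-! ### The brackets on a constant family -/

theorem hat₃_add (v w : X.C₃ k) : hat₃ (v + w) = hat₃ v + hat₃ w := by
  simp only [hat₃, map_add, LinearMap.lTensor_add, LinearMap.comp_add]

theorem hat₃_smul (r : k) (v : X.C₃ k) : hat₃ (r • v) = r • hat₃ v := by
  simp only [hat₃, map_smul, LinearMap.lTensor_smul, LinearMap.comp_smul]

variable (X k) in
/-- The linear map `H^* : C³(A) → C²(A)`. -/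
def HstarLin : X.C₃ k →ₗ[k] X.C₂ k where
  toFun := Hstar
  map_add' v w := by
    ext x y
    simp [Hstar, hat₃_add]
  map_smul' r v := by
    ext x y
    simp [Hstar, hat₃_smul]

theorem Hstar_smul (r : k) (v : X.C₃ k) : Hstar (r • v) = r • Hstar v :=
  (HstarLin X k).map_smul r v

theorem Hstar_zero : Hstar (0 : X.C₃ k) = 0 := (HstarLin X k).map_zero

variable (X k) in
/-- The Gerstenhaber product on `C²(A)` as a bilinear map. -/
def circLin : X.C₂ k →ₗ[k] X.C₂ k →ₗ[k] X.C₃ k :=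
  LinearMap.mk₂ k circ
    (fun f g h => by ext x y z; simp only [circ_apply, LinearMap.add_apply]; abel)
    (fun r f g => by ext x y z; simp only [circ_apply, LinearMap.smul_apply, smul_sub])
    (fun f g h => by ext x y z; simp only [circ_apply, LinearMap.add_apply, map_add]; abel)
    (fun r f g => by ext x y z; simp only [circ_apply, LinearMap.smul_apply, map_smul, smul_sub])

theorem circ_zero_left (g : X.C₂ k) : circ 0 g = 0 := (circLin X k).map_zero₂ g

theorem circ_zero_right (g : X.C₂ k) : circ g 0 = 0 := (circLin X k g).map_zero

theorem circ_smul_smul (r s : k) (f g : X.C₂ k) : circ (r • f) (s • g) = (r * s) • circ f g := by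
  have h := (circLin X k).map_smul₂ r f (s • g)
  have h' := (circLin X k f).map_smul s g
  exact h.trans ((congrArg (r • ·) h').trans (smul_smul r s _))

/-- The terms of the Maurer-Cartan expansion of `f`, up to the factors `± n!` (see `phi_const`). -/
def psi (f : X.B₂ k) : ℕ → X.C₂ k
  | 0 => 0
  | 1 => Gstar f
  | n + 2 => -Hstar (∑ i : Fin (n + 1), circ (psi f (i + 1)) (psi f (n + 1 - i)))

/-- The terms of the curvature of the Maurer-Cartan expansion of `f`. -/
def curv (f : X.B₂ k) (n : ℕ) : X.C₃ k :=
  ∑ p ∈ Finset.HasAntidiagonal.antidiagonal n, circ (psi f p.1) (psi f p.2)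

theorem psi_zero (f : X.B₂ k) : psi f 0 = 0 := by rw [psi]

theorem psi_one (f : X.B₂ k) : psi f 1 = Gstar f := by rw [psi]

/-- The recursion uses only positive indices; since ψ₀ = 0, adding the two end terms of the
antidiagonal changes nothing. -/
theorem psi_of_two_le (f : X.B₂ k) {n : ℕ} (hn : 2 ≤ n) : psi f n = -Hstar (curv f n) := by
  obtain ⟨n, rfl⟩ := Nat.exists_eq_add_of_le' hn
  rw [psi, curv, Finset.Nat.sum_antidiagonal_eq_sum_range_succ (fun i j => circ (psi f i) (psi f j)),
    Finset.sum_range_succ, Finset.sum_range_succ', Nat.sub_self, psi_zero, circ_zero_right,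
    circ_zero_left, add_zero, add_zero,
    ← Fin.sum_univ_eq_sum_range (fun i => circ (psi f (i + 1)) (psi f (n + 2 - (i + 1))))]
  simp only [Nat.reduceSubDiff]

theorem curv_apply (f : X.B₂ k) (n : ℕ) (x y z : X.Alg k) :
    curv f n x y z = ∑ p ∈ Finset.HasAntidiagonal.antidiagonal n,
      (psi f p.1 (psi f p.2 x y) z - psi f p.1 x (psi f p.2 y z)) := by
  simp only [curv, LinearMap.sum_apply, circ_apply]

/-! ### From shuffles to ordered pairs: signs and multiplicities -/

theorem kappa_add (t m : ℕ) (ht : t ≠ 0) (hm : m ≠ 0) :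
    kappa k t (t + m) = -(-1) ^ (t * m) := by
  obtain ⟨t, rfl⟩ := Nat.exists_eq_succ_of_ne_zero ht
  obtain ⟨m, rfl⟩ := Nat.exists_eq_succ_of_ne_zero hm
  -- The exponent of κ is (t - 1) + (m - 1)t = tm - 1.
  have e : (t + 1 - 1) + (t + 1 + (m + 1) - (t + 1) - 1) * (t + 1) + 1 = (t + 1) * (m + 1) := by
    have : t + 1 + (m + 1) - (t + 1) - 1 = m := by omega
    rw [this]
    simp only [Nat.add_sub_cancel]
    ring
  rw [kappa, Nat.succ_eq_add_one, Nat.succ_eq_add_one, ← e, pow_succ]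
  simp

theorem vee_empty {n : ℕ} (f : Fin n → X.B₂ k) : vee f ∅ = 0 := by
  rw [vee]
  refine Finset.sum_eq_zero ?_
  rintro ⟨T, hT, -⟩ -
  exact absurd hT (Finset.not_ssubset_empty T)

theorem phi_empty {n : ℕ} (f : Fin n → X.B₂ k) : phi f ∅ = 0 := by
  rw [phi_of_card_ne_one f ∅ (by simp), vee_empty, Hstar_zero]

open Classical in
/-- The cochain `v` as a sum over all subsets, without the symmetrization of the bracket. -/
theorem vee_eq_sum_powerset {n : ℕ} (f : Fin n → X.B₂ k) (S : Finset (Fin n)) :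
    vee f S = ∑ T ∈ S.powerset, -(-1 : k) ^ (T.card * (S \ T).card) •
      circ (phi f T) (phi f (S \ T)) := by
  have h0 := phi_empty f
  rcases S.eq_empty_or_nonempty with rfl | hS
  · simp only [Finset.powerset_empty, Finset.sum_singleton, h0, circ_zero_left, smul_zero,
      vee_empty]
  set F : Finset (Fin n) → X.C₃ k := fun T => -(-1 : k) ^ (T.card * (S \ T).card) •
      circ (phi f T) (phi f (S \ T)) with hF
  -- The sign is symmetric in the two cardinalities, so the two halves of the Gerstenhaber bracket
  -- are the terms of T and of its complement.
  have hterm : ∀ T : Split S, kappa k T.1.card S.card • gerst (phi f T.1) (phi f (S \ T.1)) =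
      F T.1 + F (S \ T.1) := by
    rintro ⟨T, hT, i, hi, -⟩
    have e : S.card = T.card + (S \ T).card := by
      rw [add_comm, Finset.card_sdiff_add_card_eq_card hT.1]
    have h1 : T.card ≠ 0 := Finset.card_ne_zero_of_mem hi
    have h2 : (S \ T).card ≠ 0 :=
      Finset.card_ne_zero.2 (Finset.sdiff_nonempty.2 hT.2)
    simp only [hF]
    rw [e, kappa_add _ _ h1 h2, Finset.sdiff_sdiff_eq_self hT.1, mul_comm (S \ T).card, gerst,
      smul_add]
  obtain ⟨i, hi, hmin⟩ : ∃ i ∈ S, ∀ j ∈ S, i ≤ j :=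
    ⟨S.min' hS, S.min'_mem hS, fun j hj => S.min'_le j hj⟩
  have hsub : ∑ T : Split S, (F T.1 + F (S \ T.1)) =
      ∑ T ∈ (S.powerset.filter (i ∈ ·)), (F T + F (S \ T)) := by
    -- `Split S` omits T = S; adding it is harmless because φ of the empty family is zero.
    have hS0 : F S + F (S \ S) = 0 := by
      simp only [hF, Finset.sdiff_self, h0, circ_zero_left, circ_zero_right, smul_zero, add_zero]
    have e : S.powerset.filter (i ∈ ·) = insert S (S.ssubsets.filter (i ∈ ·)) := by
      ext T
      simp only [Finset.mem_filter, Finset.mem_powerset, Finset.mem_insert, Finset.mem_ssubsets]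
      constructor
      · rintro ⟨h, h'⟩
        exact (eq_or_ssubset_of_subset h).imp id fun h => ⟨h, h'⟩
      · rintro (rfl | ⟨h, h'⟩)
        · exact ⟨subset_rfl, hi⟩
        · exact ⟨h.1, h'⟩
    rw [e, Finset.sum_insert (by simp [Finset.mem_ssubsets]), hS0, zero_add]
    refine (Finset.sum_subtype (S.ssubsets.filter (i ∈ ·)) (p := fun T => T ⊂ S ∧
      ∃ i ∈ T, ∀ j ∈ S, i ≤ j) (fun T => ?_) (fun T => F T + F (S \ T))).symm
    rw [Finset.mem_filter, Finset.mem_ssubsets]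
    refine and_congr_right fun hT => ⟨fun h => ⟨i, h, hmin⟩, ?_⟩
    rintro ⟨j, hj, hj'⟩
    rwa [le_antisymm (hmin j (hT.1 hj)) (hj' i hi)]
  rw [vee, Finset.sum_congr rfl fun T _ => hterm T, hsub, Finset.sum_add_distrib,
    ← Finset.sum_filter_add_sum_filter_not S.powerset (i ∈ ·)]
  congr 1
  -- Complementation exchanges the subsets that contain the least element with those that do not.
  refine Finset.sum_nbij' (S \ ·) (S \ ·) ?_ ?_ ?_ ?_ ?_
  · intro T hT
    simp only [Finset.mem_filter, Finset.mem_powerset] at hT ⊢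
    exact ⟨Finset.sdiff_subset, fun h => (Finset.mem_sdiff.1 h).2 hT.2⟩
  · intro T hT
    simp only [Finset.mem_filter, Finset.mem_powerset] at hT ⊢
    exact ⟨Finset.sdiff_subset, Finset.mem_sdiff.2 ⟨hi, hT.2⟩⟩
  · intro T hT
    exact Finset.sdiff_sdiff_eq_self (Finset.mem_powerset.1 (Finset.mem_filter.1 hT).1)
  · intro T hT
    exact Finset.sdiff_sdiff_eq_self (Finset.mem_powerset.1 (Finset.mem_filter.1 hT).1)
  · intro T hT
    rfl

variable (k) in
/-- The sign `(-1)^{n(n-1)/2}`. -/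
def epsilon (n : ℕ) : k := (-1) ^ n.choose 2

/-- This is C(t+m, 2) = C(t, 2) + C(m, 2) + tm. It trivializes the sign (-1)^{tm} of the
unsymmetrized sum. -/
theorem epsilon_add (t m : ℕ) :
    (-1 : k) ^ (t * m) * (epsilon k t * epsilon k m) = epsilon k (t + m) := by
  have h : t * m + (t.choose 2 + m.choose 2) = (t + m).choose 2 := by
    induction m with
    | zero => simp
    | succ m ih =>
      rw [← add_assoc t m 1, Nat.choose_succ_succ' (t + m) 1, Nat.choose_succ_succ' m 1, ← ih,
        Nat.choose_one_right, Nat.choose_one_right]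
      ring
  rw [epsilon, epsilon, epsilon, ← pow_add, ← pow_add, h]

/-- The term of T depends only on t = |T|. The C(n, t) subsets of size t, weighted by t!(n - t)!,
give n!, and `epsilon_add` makes the sign independent of t. -/
theorem vee_const_of_phi_const {N : ℕ} (f : X.B₂ k) (S : Finset (Fin N))
    (h : ∀ T ⊂ S, phi (fun _ => f) T =
      (epsilon k T.card * (T.card.factorial : k)) • psi f T.card) :
    vee (fun _ => f) S = (-(epsilon k S.card * (S.card.factorial : k))) • curv f S.card := by
  classical
  have key : ∀ T ∈ S.powerset, -(-1 : k) ^ (T.card * (S \ T).card) •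
      circ (phi (fun _ => f) T) (phi (fun _ => f) (S \ T)) =
      (-(epsilon k S.card * ((T.card.factorial : k) * ((S.card - T.card).factorial : k)))) •
        circ (psi f T.card) (psi f (S.card - T.card)) := by
    intro T hT
    rw [Finset.mem_powerset] at hT
    rcases T.eq_empty_or_nonempty with rfl | hne
    · rw [phi_empty, circ_zero_left, Finset.card_empty, psi_zero, circ_zero_left, smul_zero,
        smul_zero]
    rcases eq_or_ssubset_of_subset hT with rfl | hT'
    · rw [Finset.sdiff_self, phi_empty, Nat.sub_self, psi_zero, circ_zero_right, circ_zero_right,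
        smul_zero, smul_zero]
    have e := Finset.card_sdiff_add_card_eq_card hT
    have e' : S.card - T.card = (S \ T).card := by omega
    rw [h T hT', h _ (Finset.sdiff_ssubset hT hne), circ_smul_smul, smul_smul, e',
      ← e, add_comm, ← epsilon_add]
    congr 1
    ring
  rw [vee_eq_sum_powerset, Finset.sum_congr rfl key,
    Finset.sum_powerset_apply_card (fun t => (-(epsilon k S.card * ((t.factorial : k) *
      ((S.card - t).factorial : k)))) • circ (psi f t) (psi f (S.card - t))),
    curv, Finset.Nat.sum_antidiagonal_eq_sum_range_succ (fun i j => circ (psi f i) (psi f j)),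
    Finset.smul_sum]
  refine Finset.sum_congr rfl fun t ht => ?_
  have ht' : t ≤ S.card := Nat.lt_succ_iff.1 (Finset.mem_range.1 ht)
  rw [← Nat.cast_smul_eq_nsmul k, smul_smul, ← Nat.choose_mul_factorial_mul_factorial ht']
  congr 1
  push_cast
  ring

/-- The values of `φ` on a constant family. -/
theorem phi_const {N : ℕ} (f : X.B₂ k) (S : Finset (Fin N)) :
    phi (fun _ => f) S = (epsilon k S.card * (S.card.factorial : k)) • psi f S.card := by
  classical
  induction S using Finset.strongInduction with
  | H S ih =>
    by_cases h1 : S.card = 1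
    · obtain ⟨i, rfl⟩ := Finset.card_eq_one.1 h1
      rw [phi_of_card_eq_one, Finset.card_singleton, psi_one]
      simp [epsilon]
    · rcases S.eq_empty_or_nonempty with rfl | hS
      · rw [phi_empty, Finset.card_empty, psi_zero, smul_zero]
      · have h2 : 2 ≤ S.card := by
          have := hS.card_pos
          omega
        rw [phi_of_card_ne_one _ S h1, vee_const_of_phi_const f S ih, Hstar_smul,
          psi_of_two_le f h2]
        exact (neg_smul (M := X.C₂ k) _ _).trans (smul_neg (A := X.C₂ k) _ _).symm

theorem bracket_const (f : X.B₂ k) {n : ℕ} (hn : 2 ≤ n) (w : X.AP₃) :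
    (bracket n (fun _ => f)).1 w =
      (-(epsilon k n * (n.factorial : k))) •
        (X.idem k (X.s w.1.1) * (curv f n (X.arrow k w.1.1) (X.arrow k w.1.2.1)
          (X.arrow k w.1.2.2) * X.idem k (X.t w.1.2.2))) := by
  obtain ⟨n, rfl⟩ := Nat.exists_eq_add_of_le' hn
  have h : (bracket (n + 2) (fun _ => f)).1 w =
    hat₃ (vee (fun _ : Fin (n + 2) => f) Finset.univ)
      (X.F₃ k (1 ⊗ₜ (Finsupp.single w (1 : k) ⊗ₜ 1))) := rfl
  rw [h, hat₃_F₃, vee_const_of_phi_const f _ fun T _ => phi_const f T, Finset.card_univ,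
    Fintype.card_fin]
  simp only [LinearMap.smul_apply, smul_mul_assoc, mul_smul_comm]

end

section

variable {Q₀ Q₁ : Type*} {X : BoundQuiver Q₀ Q₁} {k : Type*} [Field k] [Fintype Q₀]

/-! ### Recursion rules for the Maurer-Cartan expansion -/

theorem IsNormalized₂.zero : IsNormalized₂ (0 : X.C₂ k) where
  left _ := rfl
  right _ _ := rfl

theorem IsNormalized₂.neg {g : X.C₂ k} (hg : IsNormalized₂ g) : IsNormalized₂ (-g) where
  left w := by rw [LinearMap.neg_apply, hg.left, neg_zero]
  right x w := by rw [LinearMap.neg_apply, LinearMap.neg_apply, hg.right, neg_zero]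

/-- Strict inequality suffices because ψₙ occurs in the curvature only next to ψ₀ = 0; this lets
normalization be proved by strong induction. -/
theorem isNormalized₃_curv_of_lt {f : X.B₂ k} {n : ℕ}
    (h : ∀ m < n, IsNormalized₂ (psi f m)) : IsNormalized₃ (curv f n) := by
  have key : ∀ p ∈ Finset.HasAntidiagonal.antidiagonal n,
      IsNormalized₃ (BoundQuiver.circ (psi f p.1) (psi f p.2)) := by
    rintro ⟨t, m⟩ hp
    have e : t + m = n := Finset.HasAntidiagonal.mem_antidiagonal.1 hp
    by_cases ht : t = 0
    · subst ht
      rw [psi_zero, circ_zero_left]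
      exact ⟨fun _ => rfl, fun _ _ => rfl⟩
    by_cases hm : m = 0
    · subst hm
      rw [psi_zero, circ_zero_right]
      exact ⟨fun _ => rfl, fun _ _ => rfl⟩
    exact (h t (by omega)).circ (h m (by omega))
  constructor
  · intro w
    rw [curv, LinearMap.sum_apply]
    exact Finset.sum_eq_zero fun p hp => (key p hp).left w
  · intro x w
    rw [curv, LinearMap.sum_apply, LinearMap.sum_apply]
    exact Finset.sum_eq_zero fun p hp => (key p hp).middle x w

theorem isNormalized₂_psi (f : X.B₂ k) (n : ℕ) : IsNormalized₂ (psi f n) := by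
  induction n using Nat.strong_induction_on with
  | _ n ih =>
    by_cases h0 : n = 0
    · subst h0
      rw [psi_zero]
      exact IsNormalized₂.zero
    by_cases h1 : n = 1
    · subst h1
      rw [psi_one]
      exact isNormalized₂_Gstar f
    rw [psi_of_two_le f (by omega)]
    exact (isNormalized₃_curv_of_lt ih).isNormalized₂_Hstar.neg

theorem isNormalized₃_curv (f : X.B₂ k) (n : ℕ) : IsNormalized₃ (curv f n) :=
  isNormalized₃_curv_of_lt fun m _ => isNormalized₂_psi f m

theorem psi_arrow_of_notMem (f : X.B₂ k) (n : ℕ) {p : Q₀} {u : List Q₁} {a c : Q₁}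
    (hx : X.IsNonzeroPath p (u ++ [a])) (h : (a, c) ∉ X.R) :
    psi f n (X.path k p (u ++ [a])) (X.arrow k c) = 0 := by
  by_cases h0 : n = 0
  · subst h0
    rw [psi_zero]
    rfl
  by_cases h1 : n = 1
  · subst h1
    rw [psi_one, arrow, Gstar_path_path f hx (arrow_isNonzeroPath c), dif_neg h]
  rw [psi_of_two_le f (by omega), LinearMap.neg_apply, LinearMap.neg_apply,
    (isNormalized₃_curv f n).Hstar_arrow hx, if_neg h, neg_zero]

/-- On a path followed by an arrow, G^* and H^* contribute only through a relation at the junction.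
-/
theorem psi_path_arrow_eq_zero (f : X.B₂ k) (n : ℕ) {p : Q₀} {u : List Q₁} {c : Q₁}
    (h : X.IsNonzeroPath p (u ++ [c])) : psi f n (X.path k p u) (X.arrow k c) = 0 := by
  rcases List.eq_nil_or_concat' u with rfl | ⟨u, a, rfl⟩
  · rw [← idem, (isNormalized₂_psi f n).left, LinearMap.zero_apply]
  · refine psi_arrow_of_notMem f n h.of_append.1 ?_
    have h2 := h.2
    rw [List.append_assoc, List.singleton_append, List.isChain_append_cons_cons] at h2
    exact h2.2.1

theorem homEE_mul_idem (f : X.B₂ k) {a c : Q₁} (h : (a, c) ∈ X.R) :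
    f.1 (toAP₂ h) * X.idem k (X.t c) = f.1 (toAP₂ h) := by
  have e := f.2 (toAP₂ h)
  rw [← e]
  change _ * X.idem k (X.t c) * X.idem k (X.t c) = _ * X.idem k (X.t c)
  rw [mul_assoc, idem_mul_idem]

/-- For n ≥ 2 the recursion puts the trivial path before a into the first argument of the curvature,
so no correction to f appears. -/
theorem psi_arrow_arrow (f : X.B₂ k) (n : ℕ) {a c : Q₁} (h : (a, c) ∈ X.R) :
    psi f n (X.arrow k a) (X.arrow k c) = if n = 1 then f.1 (toAP₂ h) else 0 := by
  have ha := arrow_isNonzeroPath (X := X) a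
  by_cases h0 : n = 0
  · subst h0
    rw [psi_zero]
    rfl
  by_cases h1 : n = 1
  · subst h1
    have e := Gstar_path_path (u := []) f ha (arrow_isNonzeroPath c)
    rw [List.nil_append] at e
    rw [psi_one, if_pos rfl, arrow, arrow, e, dif_pos h, ← idem, ← idem, homEE_mul_idem,
      ← f.2 (toAP₂ h)]
    change X.idem k (X.s a) * (X.idem k (X.s a) * _ * _) = _
    rw [← mul_assoc, ← mul_assoc, idem_mul_idem]
    rfl
  · have e := (isNormalized₃_curv f n).Hstar_arrow (u := []) ha c
    rw [List.nil_append, ← arrow, if_pos h, ← idem, (isNormalized₃_curv f n).left,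
      LinearMap.zero_apply, LinearMap.zero_apply, zero_mul] at e
    rw [psi_of_two_le f (by omega), LinearMap.neg_apply, LinearMap.neg_apply, e, neg_zero,
      if_neg h1]

/-- A value of `psi` on an arrow in the second argument ends at the target of this arrow. -/
theorem psi_arrow_mul_idem (f : X.B₂ k) (n : ℕ) (x : X.Alg k) (c : Q₁) :
    psi f n x (X.arrow k c) * X.idem k (X.t c) = psi f n x (X.arrow k c) := by
  suffices h : LinearMap.mulRight k (X.idem k (X.t c)) ∘ₗ (psi f n).flip (X.arrow k c) =
      (psi f n).flip (X.arrow k c) from LinearMap.congr_fun h x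
  refine alg_hom_ext k fun p l hl => ?_
  rw [LinearMap.comp_apply, LinearMap.flip_apply, LinearMap.mulRight_apply]
  rcases List.eq_nil_or_concat' l with rfl | ⟨u, a, rfl⟩
  · rw [← idem, (isNormalized₂_psi f n).left, LinearMap.zero_apply, zero_mul]
  by_cases h : (a, c) ∈ X.R
  swap
  · rw [psi_arrow_of_notMem f n hl h, zero_mul]
  by_cases h0 : n = 0
  · subst h0
    rw [psi_zero]
    exact zero_mul _
  by_cases h1 : n = 1
  · subst h1
    rw [psi_one, arrow, Gstar_path_path f hl (arrow_isNonzeroPath c), dif_pos h, ← idem, mul_assoc,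
      mul_assoc, idem_mul_idem]
  rw [psi_of_two_le f (by omega), LinearMap.neg_apply, LinearMap.neg_apply,
    (isNormalized₃_curv f n).Hstar_arrow hl, if_pos h, neg_mul, mul_assoc, idem_mul_idem]

/-- The basic rewriting rule. In the curvature at (u, a, c) the terms ψ(ψ(u, a), c) vanish because
ua is a nonzero path, and ψₘ(a, c) is nonzero only for m = 1. The two minus signs cancel. -/
theorem psi_path_arrow (f : X.B₂ k) (n : ℕ) {p : Q₀} {u : List Q₁} {a c : Q₁}
    (hx : X.IsNonzeroPath p (u ++ [a])) (h : (a, c) ∈ X.R) :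
    psi f (n + 1) (X.path k p (u ++ [a])) (X.arrow k c) =
      (if n = 0 then X.path k p u * f.1 (toAP₂ h) else 0) +
        psi f n (X.path k p u) (f.1 (toAP₂ h)) * X.idem k (X.t c) := by
  by_cases h0 : n = 0
  · subst h0
    rw [psi_one, psi_zero, arrow, Gstar_path_path f hx (arrow_isNonzeroPath c), dif_pos h, ← idem,
      homEE_mul_idem, if_pos rfl]
    rw [LinearMap.zero_apply, LinearMap.zero_apply, zero_mul, add_zero]
  rw [psi_of_two_le f (by omega), LinearMap.neg_apply, LinearMap.neg_apply,
    (isNormalized₃_curv f (n + 1)).Hstar_arrow hx, if_pos h, if_neg h0, zero_add, curv_apply,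
    Finset.sum_eq_single (n, 1)]
  · rw [psi_path_arrow_eq_zero f _ hx, psi_arrow_arrow f _ h, if_pos rfl, map_zero,
      LinearMap.zero_apply, zero_sub, neg_mul, neg_neg]
  · rintro ⟨t, m⟩ hq hne
    have e : t + m = n + 1 := Finset.HasAntidiagonal.mem_antidiagonal.1 hq
    have hm : m ≠ 1 := by
      rintro rfl
      exact hne (by rw [Nat.add_right_cancel e])
    rw [psi_path_arrow_eq_zero f _ hx, psi_arrow_arrow f _ h, if_neg hm, map_zero, map_zero,
      LinearMap.zero_apply, sub_zero]
  · intro hn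
    exact absurd (Finset.HasAntidiagonal.mem_antidiagonal.2 (rfl : n + 1 = n + 1)) hn

/-- The sum is the curvature at the new cut of G₁; its terms ψ(x, ψ(m, c)) vanish because mc is a
nonzero path. -/
theorem psi_path_append_arrow (f : X.B₂ k) (n : ℕ) {p w : Q₀} {l m : List Q₁} {c : Q₁}
    (hx : X.IsNonzeroPath p l) (hm : m ≠ []) (hy : X.IsNonzeroPath w (m ++ [c])) :
    psi f n (X.path k p l) (X.path k w (m ++ [c])) =
      psi f n (X.path k p l) (X.path k w m) * X.arrow k c +
        ∑ q ∈ Finset.HasAntidiagonal.antidiagonal n,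
          psi f q.1 (psi f q.2 (X.path k p l) (X.path k w m)) (X.arrow k c) := by
  by_cases h0 : n = 0
  · subst h0
    simp [psi_zero]
  by_cases h1 : n = 1
  · subst h1
    rw [psi_one, Gstar_append_singleton f hx hm hy]
    simp [psi_zero, Finset.Nat.antidiagonal_succ]
  rw [psi_of_two_le f (by omega), LinearMap.neg_apply, LinearMap.neg_apply,
    (isNormalized₃_curv f n).Hstar_append_singleton hx hm hy,
    LinearMap.neg_apply, neg_sub, sub_eq_neg_add, neg_mul, curv_apply, Finset.sum_mul]
  congr 1
  refine Finset.sum_congr rfl fun q _ => ?_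
  rw [psi_path_arrow_eq_zero f q.2 hy, map_zero, sub_zero, psi_arrow_mul_idem]

/-- If all values `psi f n x y` are multiples of a path which can be prolonged by `z`, then
`psi f n x (y z)` is obtained by prolonging it. -/
theorem psi_path_append (f : X.B₂ k) {p v w : Q₀} {l m q z : List Q₁} (r : ℕ → k)
    (hx : X.IsNonzeroPath p l) (hm : m ≠ [])
    (h : ∀ n, psi f n (X.path k p l) (X.path k w m) = r n • X.path k v q)
    (hy : X.IsNonzeroPath w (m ++ z)) (hq : X.IsNonzeroPath v (q ++ z)) (n : ℕ) :
    psi f n (X.path k p l) (X.path k w (m ++ z)) = r n • X.path k v (q ++ z) := by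
  induction z using List.reverseRecOn generalizing n with
  | nil => rw [List.append_nil, List.append_nil, h]
  | append_singleton z c ih =>
    rw [← List.append_assoc] at hy hq ⊢
    have ih := ih hy.of_append.1 hq.of_append.1
    rw [psi_path_append_arrow f n hx (by simp [hm]) hy, ih, smul_mul_assoc,
      path_mul_arrow hq.target_eq_source, ← List.append_assoc q z, Finset.sum_eq_zero, add_zero]
    -- By induction the inner value is a multiple of the path qz, and qzc is still nonzero.
    intro s _
    rw [ih, map_smul, LinearMap.smul_apply, psi_path_arrow_eq_zero f s.1 hq, smul_zero]

end

/-! ### Consequences of the recursion rules -/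

section

variable {Q₀ Q₁ : Type*} {X : BoundQuiver Q₀ Q₁} {k : Type*} [Field k] [Fintype Q₀]

/-- The value vanishes on the first arrow of m, and the prolongation rule with r = 0 carries this to
the whole of m. -/
theorem psi_path_path_eq_zero (f : X.B₂ k) (n : ℕ) {p w : Q₀} {l m : List Q₁} (hm : m ≠ [])
    (h : X.IsNonzeroPath p (l ++ m)) (hw : X.target p l = w) :
    psi f n (X.path k p l) (X.path k w m) = 0 := by
  obtain ⟨c, z, rfl⟩ := List.exists_cons_of_ne_nil hm
  have e : l ++ c :: z = l ++ [c] ++ z := by simp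
  have hc : w = X.s c := hw.symm.trans h.target_eq_source
  have h' := h.of_append.2
  rw [hw] at h'
  rw [e] at h
  have := psi_path_append f (m := [c]) (fun _ => 0) h.of_append.1.of_append.1 (by simp)
    (v := p) (q := l ++ [c]) (w := w)
    (fun n => by
      rw [zero_smul, hc, ← arrow]
      exact psi_path_arrow_eq_zero f n h.of_append.1) h' h n
  rwa [zero_smul] at this

/-- The curvature on three arrows, the first two of which form a relation, and so do the last. -/
theorem curv_arrow_arrow_arrow (f : X.B₂ k) (n : ℕ) {a b c : Q₁} (h : (a, b) ∈ X.R)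
    (h' : (b, c) ∈ X.R) :
    curv f (n + 1) (X.arrow k a) (X.arrow k b) (X.arrow k c) =
      psi f n (f.1 (toAP₂ h)) (X.arrow k c) - psi f n (X.arrow k a) (f.1 (toAP₂ h')) := by
  rw [curv_apply, Finset.sum_eq_single (n, 1)]
  · rw [psi_arrow_arrow f _ h, psi_arrow_arrow f _ h', if_pos rfl, if_pos rfl]
  · rintro ⟨t, m⟩ hq hne
    have e : t + m = n + 1 := Finset.HasAntidiagonal.mem_antidiagonal.1 hq
    have hm : m ≠ 1 := by
      rintro rfl
      exact hne (by rw [Nat.add_right_cancel e])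
    rw [psi_arrow_arrow f _ h, psi_arrow_arrow f _ h', if_neg hm, if_neg hm, map_zero, map_zero,
      LinearMap.zero_apply, sub_zero]
  · intro hn
    exact absurd (Finset.HasAntidiagonal.mem_antidiagonal.2 (rfl : n + 1 = n + 1)) hn

theorem psi_arrow_path_pair (f : X.B₂ k) (n : ℕ) {a c d : Q₁} (h : (a, c) ∈ X.R)
    (hcd : X.IsNonzeroPath (X.s c) [c, d]) :
    psi f (n + 1) (X.arrow k a) (X.path k (X.s c) [c, d]) =
      (if n = 0 then f.1 (toAP₂ h) * X.arrow k d else 0) +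
        psi f n (f.1 (toAP₂ h)) (X.arrow k d) := by
  have e := psi_path_append_arrow f (n + 1) (m := [c]) (arrow_isNonzeroPath a) (by simp) hcd
  rw [← arrow, ← arrow, psi_arrow_arrow f _ h, Finset.sum_eq_single (n, 1)] at e
  · refine e.trans ?_
    rw [psi_arrow_arrow f _ h, if_pos rfl, ite_mul, zero_mul]
    simp only [Nat.add_eq_right]
  · rintro ⟨t, m⟩ hq hne
    have e : t + m = n + 1 := Finset.HasAntidiagonal.mem_antidiagonal.1 hq
    have hm : m ≠ 1 := by
      rintro rfl
      exact hne (by rw [Nat.add_right_cancel e])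
    rw [psi_arrow_arrow f _ h, if_neg hm, map_zero, LinearMap.zero_apply]
  · intro hn
    exact absurd (Finset.HasAntidiagonal.mem_antidiagonal.2 (rfl : n + 1 = n + 1)) hn

end

variable {Q₀ Q₁ : Type*} {X : BoundQuiver Q₀ Q₁} {k : Type*} [Field k]

/-! ### The configuration -/

theorem path_ne_zero {v : Q₀} {l : List Q₁} (h : X.IsNonzeroPath v l) : X.path k v l ≠ 0 := by
  rw [path_of_nonzero k h]
  exact Finsupp.single_ne_zero.2 one_ne_zero

theorem idem_mul_path_mul_idem {v w : Q₀} (l : List Q₁)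
    (h : X.target v l = w) :
    X.idem k v * X.path k v l * X.idem k w = X.path k v l := by
  rw [idem_mul_path, path_mul_idem h]

theorem isNonzeroPath_append {v : Q₀} {u m : List Q₁} {a : Q₁}
    (h : X.IsNonzeroPath v (u ++ [a])) (h' : X.IsNonzeroPath (X.s a) (a :: m)) :
    X.IsNonzeroPath v (u ++ a :: m) := by
  refine ⟨(isPath_append _ _ _).2 ⟨h.of_append.1.1, ?_⟩, ?_⟩
  · rw [h.target_eq_source]
    exact h'.1
  · rw [List.isChain_split]
    exact ⟨h.2, h'.2⟩

theorem isNonzeroPath_pair {a b : Q₁} (h : X.t a = X.s b) (h' : (a, b) ∉ X.R) :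
    X.IsNonzeroPath (X.s a) [a, b] :=
  ⟨⟨rfl, h.symm, trivial⟩, List.isChain_pair.2 h'⟩

theorem isNonzeroPath_cons_cons {a b : Q₁} {m : List Q₁} (h : X.t a = X.s b) (h' : (a, b) ∉ X.R)
    (hm : X.IsNonzeroPath (X.s b) (b :: m)) : X.IsNonzeroPath (X.s a) (a :: b :: m) :=
  ⟨⟨rfl, h ▸ hm.1⟩, List.isChain_cons_cons.2 ⟨h', hm.2⟩⟩

namespace StarConfig

variable (S : X.StarConfig)

theorem t_α₁ : X.t S.α₁ = X.s S.α₂ := X.composable _ S.rel₁₂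

theorem t_α₂ : X.t S.α₂ = X.s S.α₃ := X.composable _ S.rel₂₃

theorem t_γ₁ : X.t S.γ₁ = X.s S.γ₂ := S.nonzero_γ.1.2.1.symm

theorem s_δ₁ : X.s S.δ₁ = X.s S.α₃ := S.nonzero_w.1.1

theorem distinct : S.α₁ ≠ S.α₂ ∧ S.α₁ ∉ S.β ∧ S.γ₁ ≠ S.α₂ ∧ S.γ₁ ≠ S.α₃ ∧ S.γ₁ ≠ S.δ₁ ∧
    S.γ₁ ≠ S.ρ ∧ S.γ₂ ≠ S.α₂ ∧ S.α₃ ≠ S.δ₁ ∧ S.α₂ ≠ S.δ₁ ∧ S.ρ ≠ S.γ₂ ∧ S.ρ ≠ S.α₂ ∧ S.ρ ≠ S.α₃ ∧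
    S.ρ ≠ S.δ₁ ∧ S.γ₁ ≠ S.γ₂ := by
  have h := S.arrows_nodup
  simp only [List.cons_append, List.nil_append, List.nodup_cons, List.mem_cons, List.mem_append,
    not_or] at h
  grind

theorem δ_target : X.target (X.t S.δ₁) S.δ = X.t S.α₃ := S.target_w

/-! ### Relations and nonzero paths forced by gentleness -/

section Gentle

variable {S}

theorem α₁_γ₁_notMem (hX : X.IsGentle) : (S.α₁, S.γ₁) ∉ X.R := fun h =>
  S.distinct.2.2.1 (hX.rel_right _ _ _ h S.rel₁₂)

theorem α₂_δ₁_notMem (hX : X.IsGentle) : (S.α₂, S.δ₁) ∉ X.R := fun h =>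
  S.distinct.2.2.2.2.2.2.2.1 (hX.rel_right _ _ _ S.rel₂₃ h)

theorem γ₂_α₃_notMem (hX : X.IsGentle) : (S.γ₂, S.α₃) ∉ X.R := fun h =>
  S.distinct.2.2.2.2.2.2.1 (hX.rel_left _ _ _ h S.rel₂₃)

theorem γ₁_γ₂_notMem : (S.γ₁, S.γ₂) ∉ X.R := List.isChain_pair.1 S.nonzero_γ.2

/-- Since α₂α₃ is a relation, α₂δ₁ is not one, and δ₁ admits only one such predecessor. -/
theorem γ₂_δ₁_mem (hX : X.IsGentle) : (S.γ₂, S.δ₁) ∈ X.R := by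
  by_contra h
  exact S.distinct.2.2.2.2.2.2.1 (hX.nonrel_left S.δ₁ _ _ (by rw [S.target_γ₂, S.s_δ₁, S.t_α₂])
    (by rw [S.s_δ₁, S.t_α₂]) h (α₂_δ₁_notMem hX))

theorem γ₁_ρ_mem (hX : X.IsGentle) : (S.γ₁, S.ρ) ∈ X.R := by
  by_contra h
  exact S.distinct.2.2.2.2.2.2.2.2.2.1 (hX.nonrel_right S.γ₁ _ _ S.source_ρ S.t_γ₁.symm h
    γ₁_γ₂_notMem)

/-- The last arrow of `v'`. -/
theorem exists_β_eq_append (S : X.StarConfig) :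
    ∃ u b, S.β = u ++ [b] ∧ X.t b = X.s S.α₂ ∧ b ≠ S.α₁ := by
  obtain ⟨u, b, h⟩ := (List.eq_nil_or_concat' S.β).resolve_left S.β_ne_nil
  refine ⟨u, b, h, ?_, ?_⟩
  · rw [← S.t_α₁, ← S.target_v, h, target_append_singleton]
  · rintro rfl
    exact S.distinct.2.1 (by rw [h]; simp)

theorem notMem_α₂ (hX : X.IsGentle) {b : Q₁} (hb : b ≠ S.α₁) : (b, S.α₂) ∉ X.R := fun h =>
  hb (hX.rel_left _ _ _ h S.rel₁₂)

/-- Since α₁α₂ is a relation, bα₂ is not one, so the other continuation bγ₁ must be. -/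
theorem mem_γ₁ (hX : X.IsGentle) {b : Q₁} (ht : X.t b = X.s S.α₂) (hb : b ≠ S.α₁) :
    (b, S.γ₁) ∈ X.R := by
  by_contra h
  exact S.distinct.2.2.1 (hX.nonrel_right b _ _ (by rw [S.source_γ₁, ht]) ht.symm h
    (notMem_α₂ hX hb))

theorem α₂_w_isNonzeroPath (hX : X.IsGentle) :
    X.IsNonzeroPath (X.s S.α₂) (S.α₂ :: S.δ₁ :: S.δ) := by
  have h := S.nonzero_w
  rw [← S.s_δ₁] at h
  exact isNonzeroPath_cons_cons (by rw [S.t_α₂, S.s_δ₁]) (α₂_δ₁_notMem hX) h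

theorem v_α₂_w_isNonzeroPath (hX : X.IsGentle) :
    X.IsNonzeroPath (X.s S.α₁) (S.β ++ S.α₂ :: S.δ₁ :: S.δ) := by
  obtain ⟨u, b, h, ht, hb⟩ := S.exists_β_eq_append
  have hv := S.nonzero_v
  rw [h] at hv ⊢
  have h1 := isNonzeroPath_append hv
    (isNonzeroPath_cons_cons ht (notMem_α₂ hX hb) (α₂_w_isNonzeroPath hX))
  simpa using h1

theorem γ₁_γ₂_α₃_isNonzeroPath (hX : X.IsGentle) :
    X.IsNonzeroPath (X.s S.γ₁) [S.γ₁, S.γ₂, S.α₃] :=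
  isNonzeroPath_cons_cons S.t_γ₁ γ₁_γ₂_notMem
    (isNonzeroPath_pair (by rw [S.target_γ₂, S.t_α₂]) (γ₂_α₃_notMem hX))

theorem α₁_γ₁_γ₂_α₃_isNonzeroPath (hX : X.IsGentle) :
    X.IsNonzeroPath (X.s S.α₁) [S.α₁, S.γ₁, S.γ₂, S.α₃] :=
  isNonzeroPath_cons_cons (by rw [S.t_α₁, S.source_γ₁]) (α₁_γ₁_notMem hX)
    (γ₁_γ₂_α₃_isNonzeroPath hX)

end Gentle

/-! ### Values of the cochain on the relations -/

theorem value_α₁_α₂ : S.value k (S.α₁, S.α₂) =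
    X.path k (X.s S.α₁) (S.β ++ [S.α₂]) + X.path k (X.s S.α₁) [S.α₁, S.γ₁, S.γ₂] := if_pos rfl

theorem value_α₂_α₃ : S.value k (S.α₂, S.α₃) =
    X.path k (X.s S.α₂) [S.γ₁, S.γ₂, S.α₃] + X.path k (X.s S.α₂) (S.α₂ :: S.δ₁ :: S.δ) := by
  have := S.distinct
  rw [value, if_neg (by grind), if_pos rfl]

theorem value_γ₂_δ₁ : S.value k (S.γ₂, S.δ₁) = X.path k (X.s S.γ₂) [S.ρ] := by
  have := S.distinct
  rw [value, if_neg (by grind), if_neg (by grind), if_pos rfl]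

theorem value_γ₁_ρ : S.value k (S.γ₁, S.ρ) = X.path k (X.s S.γ₁) [S.α₂, S.δ₁] := by
  have := S.distinct
  rw [value, if_neg (by grind), if_neg (by grind), if_neg (by grind), if_pos rfl]

theorem value_γ₁ (b : Q₁) : S.value k (b, S.γ₁) = 0 := by
  have := S.distinct
  rw [value, if_neg (by grind), if_neg (by grind), if_neg (by grind), if_neg (by grind)]

variable [Fintype Q₀]

variable (k) in
/-- The cochain with the prescribed values on relations. -/
def cochain : X.B₂ k := ⟨fun r => S.value k r.1, by
  rintro ⟨⟨a, c⟩, hr⟩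
  change X.idem k (X.s a) * S.value k (a, c) * X.idem k (X.t c) = S.value k (a, c)
  by_cases h1 : (a, c) = (S.α₁, S.α₂)
  · obtain ⟨rfl, rfl⟩ := Prod.mk.inj h1
    rw [value_α₁_α₂, mul_add, add_mul, idem_mul_path_mul_idem _ (target_append_singleton _ _ _),
      idem_mul_path_mul_idem [_, _, _] S.target_γ₂]
  by_cases h2 : (a, c) = (S.α₂, S.α₃)
  · obtain ⟨rfl, rfl⟩ := Prod.mk.inj h2
    rw [value_α₂_α₃, mul_add, add_mul,
      idem_mul_path_mul_idem (w := X.t S.α₃) [_, _, S.α₃] rfl,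
      idem_mul_path_mul_idem (_ :: _ :: _) S.δ_target]
  by_cases h3 : (a, c) = (S.γ₂, S.δ₁)
  · obtain ⟨rfl, rfl⟩ := Prod.mk.inj h3
    rw [value_γ₂_δ₁, idem_mul_path_mul_idem [_] S.target_ρ]
  by_cases h4 : (a, c) = (S.γ₁, S.ρ)
  · obtain ⟨rfl, rfl⟩ := Prod.mk.inj h4
    rw [value_γ₁_ρ, idem_mul_path_mul_idem [_, _] S.target_ρ.symm]
  rw [value, if_neg h1, if_neg h2, if_neg h3, if_neg h4, mul_zero, zero_mul]⟩

theorem cochain_toAP₂ {a c : Q₁} (h : (a, c) ∈ X.R) :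
    (S.cochain k).1 (toAP₂ h) = S.value k (a, c) := rfl

/-! ### The loop of period three and the curvature at ω -/

variable {S}

/-- Rewriting with f(γ₂δ₁) = ρ. The direct term α₁γ₁ρ contains the relation γ₁ρ, so the shift holds
for n = 0 as well. -/
theorem psi_γ₂_δ₁ (hX : X.IsGentle) (n : ℕ) :
    psi (S.cochain k) (n + 1) (X.path k (X.s S.α₁) [S.α₁, S.γ₁, S.γ₂]) (X.arrow k S.δ₁) =
      psi (S.cochain k) n (X.path k (X.s S.α₁) [S.α₁, S.γ₁]) (X.arrow k S.ρ) := by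
  have hρ : X.path k (X.s S.γ₂) [S.ρ] = X.arrow k S.ρ := by
    rw [arrow, S.source_ρ, S.t_γ₁]
  have h := psi_path_arrow (S.cochain k) n (u := [S.α₁, S.γ₁])
    (α₁_γ₁_γ₂_α₃_isNonzeroPath hX).of_append.1 (γ₂_δ₁_mem hX)
  have h0 : X.path k (X.s S.α₁) [S.α₁, S.γ₁] * X.arrow k S.ρ = 0 := by
    rw [path_mul_arrow (u := [_, _]) S.source_ρ.symm]
    refine path_of_not k fun h => ?_
    have h2 := (List.isChain_cons_cons.1 (List.isChain_cons_cons.1 h.2).2).1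
    exact h2 (γ₁_ρ_mem hX)
  rw [cochain_toAP₂, value_γ₂_δ₁, hρ, h0, ite_self, zero_add, ← S.target_ρ,
    psi_arrow_mul_idem] at h
  exact h

/-- Rewriting with f(γ₁ρ) = α₂δ₁. The direct term contains the relation α₁α₂. -/
theorem psi_γ₁_ρ (hX : X.IsGentle) (n : ℕ) :
    psi (S.cochain k) (n + 1) (X.path k (X.s S.α₁) [S.α₁, S.γ₁]) (X.arrow k S.ρ) =
      psi (S.cochain k) n (X.arrow k S.α₁) (X.path k (X.s S.α₂) [S.α₂, S.δ₁]) *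
        X.idem k (X.t S.δ₁) := by
  have h := psi_path_arrow (S.cochain k) n (u := [S.α₁]) (p := X.s S.α₁)
    (α₁_γ₁_γ₂_α₃_isNonzeroPath hX).of_append.1 (γ₁_ρ_mem hX)
  have h0 : X.path k (X.s S.α₁) [S.α₁] * X.path k (X.s S.α₂) [S.α₂, S.δ₁] = 0 := by
    rw [path_mul_path, path_of_not k, ite_self]
    exact fun h => (List.isChain_cons_cons.1 h.2).1 S.rel₁₂
  rw [cochain_toAP₂, value_γ₁_ρ, S.source_γ₁, h0, ite_self, zero_add, S.target_ρ] at h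
  exact h

theorem psi_α₁_α₂_δ₁ (hX : X.IsGentle) (n : ℕ) :
    psi (S.cochain k) n (X.arrow k S.α₁) (X.path k (X.s S.α₂) [S.α₂, S.δ₁]) =
      (if n % 3 = 1 then 1 else 0 : k) • X.path k (X.s S.α₁) (S.β ++ [S.α₂, S.δ₁]) := by
  have hbig := v_α₂_w_isNonzeroPath (S := S) hX
  have hvα : X.IsNonzeroPath (X.s S.α₁) ((S.β ++ [S.α₂]) ++ [S.δ₁]) := by
    have : S.β ++ S.α₂ :: S.δ₁ :: S.δ = (S.β ++ [S.α₂]) ++ [S.δ₁] ++ S.δ := by simp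
    rw [this] at hbig
    exact hbig.of_append.1
  -- Of f(α₁α₂)δ₁ only v'α₂δ₁ is nonzero, which feeds the loop in degree one. Since v'α₂δ₁ is a
  -- nonzero path, the summand v'α₂ contributes nothing more, and α₁γ₁γ₂ carries the loop.
  have hstep : ∀ n, psi (S.cochain k) (n + 1) (X.arrow k S.α₁)
      (X.path k (X.s S.α₂) [S.α₂, S.δ₁]) =
      (if n = 0 then X.path k (X.s S.α₁) (S.β ++ [S.α₂, S.δ₁]) else 0) +
        psi (S.cochain k) n (X.path k (X.s S.α₁) [S.α₁, S.γ₁, S.γ₂]) (X.arrow k S.δ₁) := by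
    intro n
    have h0 : X.path k (X.s S.α₁) [S.α₁, S.γ₁, S.γ₂] * X.arrow k S.δ₁ = 0 := by
      rw [arrow, path_mul_path, path_of_not k, ite_self]
      exact fun h => (List.isChain_cons_cons.1 (List.isChain_cons_cons.1
        (List.isChain_cons_cons.1 h.2).2).2).1 (γ₂_δ₁_mem hX)
    rw [psi_arrow_path_pair _ n S.rel₁₂ ((α₂_w_isNonzeroPath hX).of_append (l := [S.α₂, S.δ₁])).1,
      cochain_toAP₂, value_α₁_α₂, add_mul, h0, add_zero, path_mul_arrow hvα.target_eq_source,
      map_add, LinearMap.add_apply, psi_path_arrow_eq_zero _ n hvα, zero_add, List.append_assoc]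
    rfl
  induction n using Nat.strong_induction_on with
  | _ n ih =>
    match n with
    | 0 =>
      rw [psi_zero, if_neg (by norm_num), zero_smul]
      rfl
    | 1 =>
      rw [hstep 0, psi_zero, if_pos rfl, if_pos (by norm_num), one_smul]
      exact add_zero _
    -- The loop is not yet closed here: it runs into ψ₀ = 0.
    | 2 =>
      rw [hstep 1, psi_γ₂_δ₁ hX, psi_zero, if_neg (by norm_num), if_neg (by norm_num), zero_smul]
      exact add_zero _
    | n + 3 =>
      have hn : (n + 3) % 3 = n % 3 := by omega
      rw [hstep (n + 2), psi_γ₂_δ₁ hX, psi_γ₁_ρ hX, ih n (by omega), if_neg (by omega), zero_add,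
        smul_mul_assoc, path_mul_idem, hn]
      have : S.β ++ [S.α₂, S.δ₁] = S.β ++ [S.α₂] ++ [S.δ₁] := by simp
      rw [this, target_append_singleton]

/-- The last arrow of v' forms a relation with γ₁, and f vanishes on that relation. -/
theorem psi_v_γ₁ (hX : X.IsGentle) (n : ℕ) :
    psi (S.cochain k) n (X.path k (X.s S.α₁) S.β) (X.arrow k S.γ₁) = 0 := by
  cases n with
  | zero =>
    rw [psi_zero]
    rfl
  | succ n =>
    obtain ⟨u, b, h, ht, hb⟩ := S.exists_β_eq_append
    have hv := S.nonzero_v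
    rw [h] at hv ⊢
    rw [psi_path_arrow _ n hv (mem_γ₁ hX ht hb), cochain_toAP₂, value_γ₁, mul_zero, ite_self,
      map_zero, zero_mul, add_zero]

/-- The case n = 0 is a genuine exception: ψ₁(v'α₂, α₃) = v'α₂w' cancels ψ₁(α₁, α₂w') in the
curvature, which is why j ≥ 1 is required. -/
theorem psi_vα₂_α₃ (hX : X.IsGentle) (n : ℕ) (hn : n ≠ 0) :
    psi (S.cochain k) (n + 1) (X.path k (X.s S.α₁) (S.β ++ [S.α₂])) (X.arrow k S.α₃) = 0 := by
  have hbig := v_α₂_w_isNonzeroPath (S := S) hX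
  have hvα : X.IsNonzeroPath (X.s S.α₁) (S.β ++ [S.α₂]) := by
    have : S.β ++ S.α₂ :: S.δ₁ :: S.δ = (S.β ++ [S.α₂]) ++ S.δ₁ :: S.δ := by simp
    rw [this] at hbig
    exact hbig.of_append.1
  have h1 : psi (S.cochain k) n (X.path k (X.s S.α₁) S.β)
      (X.path k (X.s S.α₂) [S.γ₁, S.γ₂, S.α₃]) = 0 := by
    have hγ := γ₁_γ₂_α₃_isNonzeroPath (S := S) hX
    have h := psi_path_append (S.cochain k) (m := [S.γ₁]) (z := [S.γ₂, S.α₃]) (q := [S.γ₁])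
      (v := X.s S.γ₁) (w := X.s S.γ₁) (fun _ => 0) S.nonzero_v (by simp)
      (fun n => by rw [← arrow, psi_v_γ₁ hX, zero_smul]) hγ hγ n
    rw [zero_smul] at h
    rw [← S.source_γ₁]
    exact h
  rw [psi_path_arrow _ n hvα S.rel₂₃, if_neg hn, zero_add, cochain_toAP₂, value_α₂_α₃, map_add, h1,
    psi_path_path_eq_zero _ n (by simp) hbig (by rw [S.target_v, S.t_α₁]), add_zero, zero_mul]

theorem curv_omega (hX : X.IsGentle) {j : ℕ} (hj : 1 ≤ j) :
    curv (S.cochain k) (2 + 3 * j) (X.arrow k S.α₁) (X.arrow k S.α₂) (X.arrow k S.α₃) =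
      -S.bigPath k := by
  have e : 2 + 3 * j = 3 * j + 1 + 1 := by ring
  have hα := α₁_γ₁_γ₂_α₃_isNonzeroPath (S := S) hX
  have hbig := v_α₂_w_isNonzeroPath (S := S) hX
  have h2 : psi (S.cochain k) (3 * j + 1) (X.path k (X.s S.α₁) [S.α₁, S.γ₁, S.γ₂])
      (X.arrow k S.α₃) = 0 :=
    psi_arrow_of_notMem _ _ (u := [S.α₁, S.γ₁]) hα.of_append.1 (γ₂_α₃_notMem hX)
  have h3 : psi (S.cochain k) (3 * j + 1) (X.arrow k S.α₁)
      (X.path k (X.s S.α₂) [S.γ₁, S.γ₂, S.α₃]) = 0 :=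
    psi_path_path_eq_zero _ _ (by simp) hα S.t_α₁
  have e' : S.β ++ [S.α₂, S.δ₁] ++ S.δ = S.β ++ S.α₂ :: S.δ₁ :: S.δ := by simp
  have h4 := psi_path_append (S.cochain k) (m := [S.α₂, S.δ₁]) (z := S.δ)
    (q := S.β ++ [S.α₂, S.δ₁]) (v := X.s S.α₁)
    (fun n => if n % 3 = 1 then 1 else 0) (arrow_isNonzeroPath S.α₁) (by simp)
    (psi_α₁_α₂_δ₁ hX) (α₂_w_isNonzeroPath hX) (by rwa [e']) (3 * j + 1)
  rw [if_pos (by omega), one_smul, ← arrow] at h4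
  have e'' : S.bigPath k = X.path k (X.s S.α₁) (S.β ++ [S.α₂, S.δ₁] ++ S.δ) := by
    rw [bigPath]
    simp
  rw [e, curv_arrow_arrow_arrow _ _ S.rel₁₂ S.rel₂₃, cochain_toAP₂, cochain_toAP₂, value_α₁_α₂,
    value_α₂_α₃, map_add, map_add, LinearMap.add_apply, psi_vα₂_α₃ hX (3 * j) (by omega), h2, h3,
    zero_add, zero_add, zero_sub, e'']
  exact congrArg _ h4

theorem bigPath_ne_zero (hX : X.IsGentle) : S.bigPath k ≠ 0 := by
  have e : S.β ++ [S.α₂] ++ (S.δ₁ :: S.δ) = S.β ++ S.α₂ :: S.δ₁ :: S.δ := by simp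
  rw [bigPath, e]
  exact path_ne_zero (v_α₂_w_isNonzeroPath hX)

theorem idem_mul_bigPath_mul_idem :
    X.idem k (X.s S.α₁) * (S.bigPath k * X.idem k (X.t S.α₃)) = S.bigPath k := by
  rw [← mul_assoc]
  refine idem_mul_path_mul_idem _ ?_
  rw [target_append, target_append_singleton, S.t_α₂]
  exact S.target_w

end StarConfig

/-! ### The final sign and the conclusion -/

theorem epsilon_two_add_three_mul (j : ℕ) :
    epsilon k (2 + 3 * j) = -(-1) ^ (j * (j + 1) / 2) := by
  obtain ⟨m, hm⟩ := Nat.even_mul_succ_self j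
  have h1 : j * (j + 1) / 2 = m := by omega
  -- With j(j + 1) = 2m one has (2 + 3j)(1 + 3j)/2 = 9m + 1; the even part 8m is split off.
  have h2 : (2 + 3 * j).choose 2 = 2 * (4 * m) + m + 1 := by
    rw [Nat.choose_two_right]
    have : (2 + 3 * j) * (2 + 3 * j - 1) = 2 * (2 * (4 * m) + m + 1) := by
      have h : 2 + 3 * j - 1 = 1 + 3 * j := by omega
      rw [h]
      linarith
    omega
  rw [epsilon, h1, h2, pow_succ, pow_add, pow_mul]
  simp

theorem StarConfig.bracket_omega [Fintype Q₀] {S : X.StarConfig} (hX : X.IsGentle) {j : ℕ}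
    (hj : 1 ≤ j) :
    (bracket (2 + 3 * j) (fun _ => S.cochain k)).1 S.omega =
      (-(-1 : k) ^ (j * (j + 1) / 2) * ((2 + 3 * j).factorial : k)) • S.bigPath k := by
  have h := bracket_const (S.cochain k) (n := 2 + 3 * j) (by omega) S.omega
  refine h.trans ?_
  have e := S.curv_omega (k := k) hX hj
  change (-(epsilon k (2 + 3 * j) * ((2 + 3 * j).factorial : k))) • (X.idem k (X.s S.α₁) *
    (curv (S.cochain k) (2 + 3 * j) (X.arrow k S.α₁) (X.arrow k S.α₂) (X.arrow k S.α₃) *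
      X.idem k (X.t S.α₃))) = _
  rw [e, neg_mul, mul_neg, S.idem_mul_bigPath_mul_idem, smul_neg, neg_smul, neg_neg,
    epsilon_two_add_three_mul]

end BoundQuiver

end

theorem mainTheorem4 {k : Type*} [Field k] [CharZero k] {Q₀ Q₁ : Type*} [Fintype Q₀]
    (X : BoundQuiver Q₀ Q₁) (hX : X.IsGentle) (S : X.StarConfig) :
    ((S.γ₂, S.δ₁) ∈ X.R ∧ (S.γ₁, S.ρ) ∈ X.R) ∧
    (∃ f : X.B₂ k, (∀ r : X.AP₂, f.1 r = S.value k r.1) ∧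
      ∀ j : ℕ, 1 ≤ j →
        (BoundQuiver.bracket (2 + 3 * j) (fun _ => f)).1 S.omega ≠ 0 ∧
        (BoundQuiver.bracket (2 + 3 * j) (fun _ => f)).1 S.omega =
          (-(-1 : k) ^ (j * (j + 1) / 2) * ((2 + 3 * j).factorial : k)) • S.bigPath k) ∧
    ¬ ∃ N : ℕ, ∀ n : ℕ, N ≤ n → ∀ f : Fin n → X.B₂ k, BoundQuiver.bracket n f = 0 := by
  have key : ∀ j : ℕ, 1 ≤ j →
      (BoundQuiver.bracket (2 + 3 * j) (fun _ => S.cochain k)).1 S.omega ≠ 0 := by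
    intro j hj
    rw [BoundQuiver.StarConfig.bracket_omega hX hj]
    refine smul_ne_zero (mul_ne_zero (neg_ne_zero.2 (pow_ne_zero _ ?_))
      (Nat.cast_ne_zero.2 (Nat.factorial_ne_zero _)))
      (BoundQuiver.StarConfig.bigPath_ne_zero hX)
    exact neg_ne_zero.2 one_ne_zero
  refine ⟨⟨BoundQuiver.StarConfig.γ₂_δ₁_mem hX, BoundQuiver.StarConfig.γ₁_ρ_mem hX⟩,
    ⟨S.cochain k, fun _ => rfl, fun j hj =>
      ⟨key j hj, BoundQuiver.StarConfig.bracket_omega hX hj⟩⟩, ?_⟩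
  rintro ⟨N, h⟩
  -- The choice j = N + 1 ensures both j ≥ 1 and 2 + 3j ≥ N.
  refine key (N + 1) (by omega) ?_
  rw [h _ (by omega)]
  rfl
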